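/- Let $n\ge 1$ and let $\Omega\subset\mathbb R^n$ be a bounded open set whose boundary $\partial\Omega$ is a $C^2$-smooth hypersurface (codimension one). For $x\in\Omega$ put $d(x)=\operatorname{dist}(x,\partial\Omega)$, and let $d_\Omega>0$ be the largest constant such that, at every $x\in\Omega$ with $d(x)<d_\Omega$, the function $d$ is twice differentiable with $|\nabla d(x)|\le 1$. Let $V\in L^\infty_{\mathrm{loc}}(\Omega)$ be real-valued and let $H=-\Delta+V$ with domain $C_0^\infty(\Omega)$ (complex-valued functions). Write $\langle u,v\rangle=\int_\Omega \overline{u}\,v\,dx$, and let $\|\cdot\|$ be the norm of $L^2(\Omega)$. Let $G\in C^1((0,\infty);\mathbb R)$ satisfy the following condition $(\Sigma)$: there is $d_0$ with $0<d_0\le d_\Omega$ such that 1. $0\le G'(t)\le \frac1t$ for $t\in(0,d_0)$, and $G'(t)=0$ for $t\ge d_0$; 2. $\displaystyle\sum_{k=1}^\infty 4^{-k}e^{-2G(2^{-k}\rho_0)}=\infty$ for every $\rho_0$ with $0<\rho_0\le \frac{d_0}{2}$. Set $g(x)=G(d(x))$ for $x\in\Omega$, and assume that there exist $E\in\mathbb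 R$ and $c>0$ such that $$\langle\varphi,(H-E)\varphi\rangle-\int_\Omega|\nabla g(x)|^2|\varphi(x)|^2\,dx\;\ge\; c\,\|\varphi\|^2\qquad\text{for all }\varphi\in C_0^\infty(\Omega).$$ If $\psi\in L^2(\Omega)\cap H^1_{\mathrm{loc}}(\Omega)$ is a weak solution of $H\psi=E\psi$, that is, $\langle\psi,(H-E)\varphi\rangle=0$ for every $\varphi\in C_0^\infty(\Omega)$, then $\psi=0$ almost everywhere in $\Omega$. -/

import Mathlib

open MeasureTheory Filter TopologicalSpace Set
open scoped Distributions ComplexConjugate ENNReal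

noncomputable section

namespace Agmon

variable {n : ℕ}

/-- The boundary of `Ω` is a hypersurface of class `C²` (of codimension one): near each of its
points it is the zero set of a `C²` function with non-vanishing gradient. Every domain with `C²`
boundary in the usual sense (lying locally on one side of such a zero set) satisfies this. -/
def HasC2Boundary (Ω : Set (EuclideanSpace ℝ (Fin n))) : Prop :=
  ∀ p ∈ frontier Ω, ∃ U : Set (EuclideanSpace ℝ (Fin n)), IsOpen U ∧ p ∈ U ∧
    ∃ F : EuclideanSpace ℝ (Fin n) → ℝ, ContDiffOn ℝ 2 F U ∧
      (∀ x ∈ U, gradient F x ≠ 0) ∧ frontier Ω ∩ U = {x ∈ U | F x = 0}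

/-- `d(x) = dist(x, ∂Ω)`. -/
def boundaryDist (Ω : Set (EuclideanSpace ℝ (Fin n))) (x : EuclideanSpace ℝ (Fin n)) : ℝ :=
  Metric.infDist x (frontier Ω)

/-- The number `δ > 0` is such that at every `x ∈ Ω` with `d(x) < δ` the function `d` is
twice differentiable, with `|∇d(x)| ≤ 1`. (The set of these `x` is open.) -/
def IsCollarWidth (Ω : Set (EuclideanSpace ℝ (Fin n))) (δ : ℝ) : Prop :=
  0 < δ ∧ ∀ x ∈ Ω, boundaryDist Ω x < δ →
    DifferentiableAt ℝ (boundaryDist Ω) x ∧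
    DifferentiableAt ℝ (fderiv ℝ (boundaryDist Ω)) x ∧
    ‖gradient (boundaryDist Ω) x‖ ≤ 1

/-- The constant `d_Ω` of the domain: the largest collar width. For a non-empty bounded open `Ω`
the collar widths are bounded, since `d` is not differentiable at its maximum points; if there is
one, then the supremum is one, too. -/
def collarWidth (Ω : Set (EuclideanSpace ℝ (Fin n))) : ℝ :=
  sSup {δ | IsCollarWidth Ω δ}

/-- Condition (Σ) on a function `G : (0, ∞) → ℝ`, relative to the constant `dΩ` of the domain.
Only the values of `G` on `(0, ∞)` matter. -/
structure ConditionSigma (dΩ : ℝ) (G : ℝ → ℝ) : Prop where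
  contDiffOn : ContDiffOn ℝ 1 G (Ioi 0)
  exists_d₀ : ∃ d₀ : ℝ, 0 < d₀ ∧ d₀ ≤ dΩ ∧
    (∀ t ∈ Ioo 0 d₀, 0 ≤ deriv G t ∧ deriv G t ≤ 1 / t) ∧
    (∀ t, d₀ ≤ t → deriv G t = 0) ∧
    ∀ ρ₀ : ℝ, 0 < ρ₀ → ρ₀ ≤ d₀ / 2 →
      Tendsto (fun N : ℕ => ∑ k ∈ Finset.Icc 1 N,
        (4 : ℝ)⁻¹ ^ k * Real.exp (-2 * G ((2 : ℝ)⁻¹ ^ k * ρ₀))) atTop atTop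

/-- `V ∈ L^∞_loc(Ω)`, for a real-valued potential `V`. -/
def MemLinftyLoc (Ω : Opens (EuclideanSpace ℝ (Fin n))) (V : EuclideanSpace ℝ (Fin n) → ℝ) :
    Prop :=
  ∀ K : Set (EuclideanSpace ℝ (Fin n)), IsCompact K → K ⊆ Ω → MemLp V ∞ (volume.restrict K)

/-- `u ∈ L²_loc(Ω)`. -/
def MemL2Loc (Ω : Opens (EuclideanSpace ℝ (Fin n))) (u : EuclideanSpace ℝ (Fin n) → ℂ) : Prop :=
  ∀ K : Set (EuclideanSpace ℝ (Fin n)), IsCompact K → K ⊆ Ω → MemLp u 2 (volume.restrict K)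

/-- `w` is the weak partial derivative `∂ᵢ u` in `Ω`. -/
def IsWeakPartial (Ω : Opens (EuclideanSpace ℝ (Fin n))) (i : Fin n)
    (u w : EuclideanSpace ℝ (Fin n) → ℂ) : Prop :=
  ∀ φ : 𝓓(Ω, ℂ), ∫ x in Ω, u x * fderiv ℝ φ x (EuclideanSpace.single i 1) =
    - ∫ x in Ω, w x * φ x

/-- `u ∈ H¹_loc(Ω)`. -/
def MemH1Loc (Ω : Opens (EuclideanSpace ℝ (Fin n))) (u : EuclideanSpace ℝ (Fin n) → ℂ) : Prop :=
  MemL2Loc Ω u ∧ ∀ i : Fin n, ∃ w : EuclideanSpace ℝ (Fin n) → ℂ,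
    MemL2Loc Ω w ∧ IsWeakPartial Ω i u w

/-- The operator `H = -Δ + V` on `C₀^∞(Ω)`. -/
def schrodinger (Ω : Opens (EuclideanSpace ℝ (Fin n))) (V : EuclideanSpace ℝ (Fin n) → ℝ)
    (φ : 𝓓(Ω, ℂ)) (x : EuclideanSpace ℝ (Fin n)) : ℂ :=
  -(Laplacian.laplacian (φ : EuclideanSpace ℝ (Fin n) → ℂ) x) + (V x : ℂ) * φ x

/-- The pairing `⟨u, v⟩ = ∫_Ω ū v dx`. -/
def pairing (Ω : Opens (EuclideanSpace ℝ (Fin n))) (u v : EuclideanSpace ℝ (Fin n) → ℂ) : ℂ :=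
  ∫ x in Ω, conj (u x) * v x

/-- `ψ` is a weak solution of `Hψ = Eψ` in `Ω`: it lies in `H¹_loc(Ω)` and
`⟨ψ, (H - E)φ⟩ = 0` for all `φ ∈ C₀^∞(Ω)`. -/
def IsWeakSolution (Ω : Opens (EuclideanSpace ℝ (Fin n))) (V : EuclideanSpace ℝ (Fin n) → ℝ)
    (E : ℝ) (ψ : EuclideanSpace ℝ (Fin n) → ℂ) : Prop :=
  MemH1Loc Ω ψ ∧
    ∀ φ : 𝓓(Ω, ℂ), pairing Ω ψ (fun x => schrodinger Ω V φ x - (E : ℂ) * φ x) = 0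

end Agmon

end

noncomputable section

namespace Agmon

open scoped Convolution Topology
open ContinuousLinearMap (lsmul)

/-! The proof is Agmon's method with a cut-off near the boundary. Formally, put `φ = f ψ` with `f`
real, `C¹` and compactly supported in `Ω` into the positivity hypothesis. Since `(H - E)ψ = 0`, the
localization formula reduces the energy of `f ψ` to `∫ |∇f|² |ψ|²`, so that `∫ (|∇f|² - (|∇g|² + c)
f²) |ψ|² ≥ 0` (`integral_localized_nonneg`).

Take `f = e^g χ`, where `χ` is a function of `d` that vanishes for `d ≤ ρ` and equals `1` for `d ≥
2ρ`. Where `χ = 1`, `|∇f|² ≤ |∇g|² f²`-type terms cancel and only `-c e^{2g} |ψ|²` is left. In the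
shell `ρ ≤ d < 2ρ` the bound `G' ≤ 1/t` keeps the remainder below a constant times `ρ⁻² e^{2G(2ρ)}`.
Hence the mass of `ψ` in `{d ≥ r}` is controlled by that of a single thin shell
(`integral_le_integral_shell`). For `2ρ = 2⁻ᵏ ρ₀` the shells are disjoint, and adding the estimates
bounds `∑ 4⁻ᵏ e^{-2G(2⁻ᵏ ρ₀)}` times the mass in `{d ≥ r}` by a multiple of `‖ψ‖²`. The sum
diverges, so that mass is zero; then `r → 0`.

The formal substitution needs smooth test functions. For smooth `f`, `ψ` is replaced by
mollifications `u_j`. Testing the weak equation with translated bumps shows that, near the support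
of `f`, `Δu_j` is the mollification of `(V - E)ψ` (`laplacian_convolution_eq_of_isWeakSolution`).
Every term is then an `L²` pairing of mollified functions and passes to the limit. A second
mollification, of `f`, reaches `C¹` weights, the class of `f = e^g χ`. -/

theorem exists_contDiffBump_tendsto_rOut (E : Type*) [NormedAddCommGroup E] :
    ∃ φ : ℕ → ContDiffBump (0 : E), Tendsto (fun j => (φ j).rOut) atTop (𝓝 0) :=
  ⟨fun j => ⟨1 / ((j : ℝ) + 1) / 2, 1 / ((j : ℝ) + 1), by positivity,
    half_lt_self (by positivity)⟩, tendsto_one_div_add_atTop_nhds_zero_nat⟩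

/-! ### Mollification in `L²` -/

section Mollifier

variable {E : Type*} [NormedAddCommGroup E] [NormedSpace ℝ E] [FiniteDimensional ℝ E]
  [MeasurableSpace E] [BorelSpace E] {μ : Measure E} [μ.IsAddHaarMeasure]

/-- The normalized bump is a probability density, so at each point the `L¹` norm for that density is
at most the `L²` norm; Tonelli and translation invariance finish. The strongly measurable
representative `k` provides the joint measurability that Tonelli requires. -/
theorem eLpNorm_normed_convolution_le (φ : ContDiffBump (0 : E)) {h : E → ℂ}
    (hh : AEStronglyMeasurable h μ) :
    eLpNorm (φ.normed μ ⋆[lsmul ℝ ℝ, μ] h) 2 μ ≤ eLpNorm h 2 μ := by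
  obtain ⟨k, hk, hhk⟩ := hh
  rw [convolution_congr (L := lsmul ℝ ℝ) (EventuallyEq.refl _ (φ.normed μ)) hhk,
    eLpNorm_congr_ae hhk]
  set ρ : E → ℝ≥0∞ := fun t => ENNReal.ofReal (φ.normed μ t) with hρ
  have hρm : Measurable ρ := (φ.continuous_normed.measurable).ennreal_ofReal
  set ν : Measure E := μ.withDensity ρ with hν
  have hνp : IsProbabilityMeasure ν := by
    constructor
    rw [hν, withDensity_apply _ MeasurableSet.univ, Measure.restrict_univ, hρ,
      ← ofReal_integral_eq_lintegral_ofReal φ.integrable_normed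
        (Eventually.of_forall φ.nonneg_normed), φ.integral_normed, ENNReal.ofReal_one]
  have key : ∀ x, ‖(φ.normed μ ⋆[lsmul ℝ ℝ, μ] k) x‖ₑ ^ (2 : ℝ) ≤
      ∫⁻ t, ‖k (x - t)‖ₑ ^ (2 : ℝ) ∂ν := by
    intro x
    have hm : StronglyMeasurable fun t => k (x - t) := hk.comp_measurable (by fun_prop)
    have h1 : ‖(φ.normed μ ⋆[lsmul ℝ ℝ, μ] k) x‖ₑ ≤ eLpNorm (fun t => k (x - t)) 1 ν := by
      rw [eLpNorm_one_eq_lintegral_enorm, hν,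
        lintegral_withDensity_eq_lintegral_mul _ hρm hm.enorm]
      refine (enorm_integral_le_lintegral_enorm _).trans (le_of_eq (lintegral_congr fun t => ?_))
      simp only [ContinuousLinearMap.lsmul_apply, Pi.mul_apply, hρ, enorm_smul]
      rw [Real.enorm_of_nonneg (φ.nonneg_normed t)]
    have h2 := h1.trans (eLpNorm_le_eLpNorm_of_exponent_le (p := 1) (q := 2) (by norm_num)
      hm.aestronglyMeasurable)
    rw [eLpNorm_eq_lintegral_rpow_enorm_toReal (by norm_num) (by norm_num)] at h2
    simp only [ENNReal.toReal_ofNat] at h2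
    refine (ENNReal.rpow_le_rpow h2 (by norm_num : (0 : ℝ) ≤ 2)).trans (le_of_eq ?_)
    rw [← ENNReal.rpow_mul]; norm_num
  rw [eLpNorm_eq_lintegral_rpow_enorm_toReal (by norm_num) (by norm_num),
    eLpNorm_eq_lintegral_rpow_enorm_toReal (by norm_num) (by norm_num)]
  simp only [ENNReal.toReal_ofNat]
  refine ENNReal.rpow_le_rpow ?_ (by norm_num)
  calc ∫⁻ x, ‖(φ.normed μ ⋆[lsmul ℝ ℝ, μ] k) x‖ₑ ^ (2 : ℝ) ∂μ
      ≤ ∫⁻ x, ∫⁻ t, ‖k (x - t)‖ₑ ^ (2 : ℝ) ∂ν ∂μ := lintegral_mono key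
    _ = ∫⁻ t, ∫⁻ x, ‖k (x - t)‖ₑ ^ (2 : ℝ) ∂μ ∂ν := by
        rw [lintegral_lintegral_swap]
        exact ((hk.comp_measurable (measurable_fst.sub measurable_snd)).enorm.pow_const
          _).aemeasurable
    _ = ∫⁻ t, ∫⁻ x, ‖k x‖ₑ ^ (2 : ℝ) ∂μ ∂ν := by
        refine lintegral_congr fun t => ?_
        exact lintegral_sub_right_eq_self (fun x => ‖k x‖ₑ ^ (2 : ℝ)) t
    _ = _ := by simp

/-- Uniform continuity makes the error uniformly small, and for bump radius below `1` it lives in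
one fixed compact set of finite measure. -/
theorem tendsto_eLpNorm_normed_convolution_sub_of_continuous {φ : ℕ → ContDiffBump (0 : E)}
    (hφ : Tendsto (fun j => (φ j).rOut) atTop (𝓝 0)) {h : E → ℂ}
    (hc : Continuous h) (hs : HasCompactSupport h) :
    Tendsto (fun j => eLpNorm (((φ j).normed μ ⋆[lsmul ℝ ℝ, μ] h) - h) 2 μ) atTop (𝓝 0) := by
  have huc := hs.uniformContinuous_of_continuous hc
  set K := Metric.cthickening 1 (tsupport h) with hK
  have hKc : IsCompact K := hs.cthickening
  have hKm : μ K ≠ ∞ := hKc.measure_lt_top.ne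
  rw [ENNReal.tendsto_nhds_zero]
  intro ε hε
  obtain ⟨δ, hδ, hδε⟩ : ∃ δ : ℝ, 0 < δ ∧ μ K ^ (1 / 2 : ℝ) * ENNReal.ofReal δ ≤ ε := by
    have hM : μ K ^ (1 / 2 : ℝ) ≠ ∞ := ENNReal.rpow_ne_top_of_nonneg (by norm_num) hKm
    have : Tendsto (fun δ : ℝ => μ K ^ (1 / 2 : ℝ) * ENNReal.ofReal δ) (𝓝[>] 0) (𝓝 0) := by
      have h0 : Tendsto (fun δ : ℝ => ENNReal.ofReal δ) (𝓝[>] 0) (𝓝 0) := by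
        have := (ENNReal.continuous_ofReal.tendsto 0).mono_left (nhdsWithin_le_nhds (s := Ioi 0))
        simpa using this
      simpa using ENNReal.Tendsto.const_mul h0 (Or.inr hM)
    obtain ⟨δ, h1, h2⟩ := ((this.eventually (ge_mem_nhds hε)).and self_mem_nhdsWithin).exists
    exact ⟨δ, h2, h1⟩
  obtain ⟨r, hr, hr'⟩ := Metric.uniformContinuous_iff.1 huc δ hδ
  filter_upwards [hφ.eventually (gt_mem_nhds hr), hφ.eventually (gt_mem_nhds one_pos)] with j hj hj1
  have hb : ∀ x, ‖(((φ j).normed μ ⋆[lsmul ℝ ℝ, μ] h) - h) x‖ ≤ δ := by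
    intro x
    rw [Pi.sub_apply, ← dist_eq_norm]
    refine ContDiffBump.dist_normed_convolution_le hc.aestronglyMeasurable fun y hy => ?_
    exact (hr' ((Metric.mem_ball.1 hy).trans hj)).le
  have hz : ∀ x ∉ K, (((φ j).normed μ ⋆[lsmul ℝ ℝ, μ] h) - h) x = 0 := by
    intro x hx
    have hxy : ∀ y ∈ Metric.ball x (φ j).rOut, h y = 0 := by
      intro y hy
      by_contra hne
      exact hx (Metric.mem_cthickening_of_dist_le x y 1 _
        (subset_tsupport h hne) ((dist_comm x y).trans_le ((Metric.mem_ball.1 hy).le.trans hj1.le)))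
    have hx0 : h x = 0 := hxy x (Metric.mem_ball_self (φ j).rOut_pos)
    rw [Pi.sub_apply, ContDiffBump.normed_convolution_eq_right, sub_self]
    intro y hy
    rw [hxy y hy, hx0]
  rw [← eLpNorm_restrict_eq_of_support_subset (s := K) (fun x hx => by
    by_contra hn; exact hx (hz x hn))]
  refine (eLpNorm_le_of_ae_bound (C := δ) (Eventually.of_forall hb)).trans ?_
  simpa using hδε

/-- An `ε/3` argument: `h` is approximated by a continuous `k` of compact support, and mollification
does not increase the norm of `h - k`. -/
theorem tendsto_eLpNorm_normed_convolution_sub {φ : ℕ → ContDiffBump (0 : E)}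
    (hφ : Tendsto (fun j => (φ j).rOut) atTop (𝓝 0)) {h : E → ℂ} (hh : MemLp h 2 μ) :
    Tendsto (fun j => eLpNorm (((φ j).normed μ ⋆[lsmul ℝ ℝ, μ] h) - h) 2 μ) atTop (𝓝 0) := by
  rw [ENNReal.tendsto_nhds_zero]
  intro ε hε
  have hε3 : ε / 3 ≠ 0 := (ENNReal.div_pos hε.ne' (by norm_num)).ne'
  obtain ⟨k, hks, hkε, hkc, hkL⟩ := hh.exists_hasCompactSupport_eLpNorm_sub_le (by norm_num) hε3
  filter_upwards [ENNReal.tendsto_nhds_zero.1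
    (tendsto_eLpNorm_normed_convolution_sub_of_continuous (μ := μ) hφ hkc hks) (ε / 3)
    (pos_iff_ne_zero.2 hε3)] with j hj
  have hcont : Continuous ((φ j).normed μ) := (φ j).continuous_normed
  have hcs : HasCompactSupport ((φ j).normed μ) := (φ j).hasCompactSupport_normed
  have hex : ∀ {w : E → ℂ}, MemLp w 2 μ →
      ConvolutionExists ((φ j).normed μ) w (lsmul ℝ ℝ) μ := fun hw =>
    hcs.convolutionExists_left _ hcont (hw.locallyIntegrable (by norm_num))
  have hcm : ∀ {w : E → ℂ}, MemLp w 2 μ →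
      AEStronglyMeasurable ((φ j).normed μ ⋆[lsmul ℝ ℝ, μ] w) μ := fun hw =>
    (hcs.continuous_convolution_left _ hcont
      (hw.locallyIntegrable (by norm_num))).aestronglyMeasurable
  have hsub : ((φ j).normed μ ⋆[lsmul ℝ ℝ, μ] (h - k)) =
      ((φ j).normed μ ⋆[lsmul ℝ ℝ, μ] h) - ((φ j).normed μ ⋆[lsmul ℝ ℝ, μ] k) := by
    have h1 := (hex (hh.sub hkL)).distrib_add (hex hkL)
    rw [sub_add_cancel] at h1
    rw [h1, add_sub_cancel_right]
  have hdec : ((φ j).normed μ ⋆[lsmul ℝ ℝ, μ] h) - h =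
      ((φ j).normed μ ⋆[lsmul ℝ ℝ, μ] (h - k)) +
        ((((φ j).normed μ ⋆[lsmul ℝ ℝ, μ] k) - k) + (k - h)) := by
    rw [hsub]; abel
  rw [hdec]
  refine (eLpNorm_add_le (hcm (hh.sub hkL)) (((hcm hkL).sub hkL.1).add (hkL.1.sub hh.1))
    (by norm_num)).trans ?_
  refine (add_le_add ((eLpNorm_normed_convolution_le _ (hh.1.sub hkL.1)).trans hkε)
    ((eLpNorm_add_le ((hcm hkL).sub hkL.1) (hkL.1.sub hh.1) (by norm_num)).trans
      (add_le_add hj ((eLpNorm_sub_comm _ _ _ _).trans_le hkε)))).trans ?_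
  rw [← add_assoc, ENNReal.add_thirds]

end Mollifier

/-- The integral is the `L²` inner product of `U j` with `A * W j`. Multiplication by the bounded
`A` is continuous on `L²`, and the inner product is jointly continuous. -/
theorem tendsto_integral_mul_conj_mul {α : Type*} [MeasurableSpace α] {μ : Measure α}
    {u w A : α → ℂ} {U W : ℕ → α → ℂ} {M : ℝ}
    (hA : AEStronglyMeasurable A μ) (hAM : ∀ᵐ x ∂μ, ‖A x‖ ≤ M)
    (hu : MemLp u 2 μ) (hw : MemLp w 2 μ) (hU : ∀ j, MemLp (U j) 2 μ) (hW : ∀ j, MemLp (W j) 2 μ)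
    (hUu : Tendsto (fun j => eLpNorm (U j - u) 2 μ) atTop (𝓝 0))
    (hWw : Tendsto (fun j => eLpNorm (W j - w) 2 μ) atTop (𝓝 0)) :
    Tendsto (fun j => ∫ x, A x * (conj (U j x) * W j x) ∂μ) atTop
      (𝓝 (∫ x, A x * (conj (u x) * w x) ∂μ)) := by
  have hAw : ∀ {v : α → ℂ}, MemLp v 2 μ → MemLp (fun x => A x * v x) 2 μ := fun hv =>
    hv.of_le_mul (c := M) (hA.mul hv.1) (hAM.mono fun x hx => by
      rw [norm_mul]; exact mul_le_mul_of_nonneg_right hx (norm_nonneg _))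
  have h1 : Tendsto (fun j => (hU j).toLp) atTop (𝓝 hu.toLp) :=
    (Lp.tendsto_Lp_iff_tendsto_eLpNorm'' _ _ _ _).2 hUu
  have h2 : Tendsto (fun j => (hAw (hW j)).toLp) atTop (𝓝 (hAw hw).toLp) := by
    refine (Lp.tendsto_Lp_iff_tendsto_eLpNorm'' _ _ _ _).2 ?_
    refine tendsto_of_tendsto_of_tendsto_of_le_of_le tendsto_const_nhds
      (h := fun j => ENNReal.ofReal M * eLpNorm (W j - w) 2 μ) ?_ (fun _ => zero_le) fun j => ?_
    · simpa using ENNReal.Tendsto.const_mul hWw (Or.inr ENNReal.ofReal_ne_top)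
    · refine eLpNorm_le_mul_eLpNorm_of_ae_le_mul (hAM.mono fun x hx => ?_) 2
      simp only [Pi.sub_apply]
      rw [← mul_sub, norm_mul]
      exact mul_le_mul_of_nonneg_right hx (norm_nonneg _)
  have h3 : ∀ {a b : α → ℂ} (ha : MemLp a 2 μ) (hb : MemLp b 2 μ),
      inner ℂ ha.toLp (hAw hb).toLp = ∫ x, A x * (conj (a x) * b x) ∂μ := by
    intro a b ha hb
    rw [L2.inner_def]
    refine integral_congr_ae ?_
    filter_upwards [ha.coeFn_toLp, (hAw hb).coeFn_toLp] with x hx hy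
    rw [hx, hy, RCLike.inner_apply]
    ring
  have h4 := h1.inner (𝕜 := ℂ) h2
  rw [h3 hu hw] at h4
  exact h4.congr fun j => h3 (hU j) (hW j)

end Agmon

/-! ### Partial derivatives, Laplacians and the localization formula -/

namespace Agmon

open scoped Convolution Topology ContDiff
open ContinuousLinearMap (lsmul)

variable {n : ℕ} {F : Type*} [NormedAddCommGroup F] [NormedSpace ℝ F]

/-- The partial derivative `∂ᵢ f`. -/
def partialDeriv (i : Fin n) (f : EuclideanSpace ℝ (Fin n) → F) (x : EuclideanSpace ℝ (Fin n)) :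
    F :=
  fderiv ℝ f x (EuclideanSpace.single i 1)

theorem contDiff_partialDeriv {f : EuclideanSpace ℝ (Fin n) → F} {k m : WithTop ℕ∞}
    (hf : ContDiff ℝ m f) (hkm : k + 1 ≤ m) (i : Fin n) : ContDiff ℝ k (partialDeriv i f) :=
  (hf.fderiv_right hkm).clm_apply contDiff_const

theorem two_le_infty : (2 : WithTop ℕ∞) ≤ (∞ : WithTop ℕ∞) := WithTop.coe_le_coe.2 le_top

theorem one_le_infty : (1 : WithTop ℕ∞) ≤ (∞ : WithTop ℕ∞) := WithTop.coe_le_coe.2 le_top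

theorem laplacian_eq_sum_partialDeriv {f : EuclideanSpace ℝ (Fin n) → F} (hf : ContDiff ℝ 2 f)
    (x : EuclideanSpace ℝ (Fin n)) :
    Laplacian.laplacian f x = ∑ i, partialDeriv i (partialDeriv i f) x := by
  rw [InnerProductSpace.laplacian_eq_iteratedFDeriv_orthonormalBasis f
    (EuclideanSpace.basisFun (Fin n) ℝ)]
  refine Finset.sum_congr rfl fun i _ => ?_
  have hd : DifferentiableAt ℝ (fderiv ℝ f) x :=
    (hf.fderiv_right (m := 1) (by norm_num)).differentiable (by norm_num) x
  rw [iteratedFDeriv_two_apply]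
  unfold partialDeriv
  rw [fderiv_clm_apply hd (differentiableAt_const _)]
  simp

theorem norm_gradient_sq_eq_sum (f : EuclideanSpace ℝ (Fin n) → ℝ)
    (x : EuclideanSpace ℝ (Fin n)) :
    ‖gradient f x‖ ^ 2 = ∑ i, partialDeriv i f x ^ 2 := by
  rw [EuclideanSpace.norm_sq_eq]
  refine Finset.sum_congr rfl fun i _ => ?_
  have : gradient f x i = partialDeriv i f x := by
    rw [partialDeriv, ← inner_gradient_left, EuclideanSpace.inner_single_right]
    simp
  rw [this, Real.norm_eq_abs, sq_abs]

theorem partialDeriv_eq_zero_of_notMem_tsupport {f : EuclideanSpace ℝ (Fin n) → F} (i : Fin n)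
    {x : EuclideanSpace ℝ (Fin n)} (hx : x ∉ tsupport f) : partialDeriv i f x = 0 := by
  rw [partialDeriv, fderiv_of_notMem_tsupport ℝ hx]; simp

theorem partialDeriv_comp_const_sub {f : EuclideanSpace ℝ (Fin n) → F} (hf : ContDiff ℝ 1 f)
    (i : Fin n) (x y : EuclideanSpace ℝ (Fin n)) :
    partialDeriv i (fun t => f (x - t)) y = - partialDeriv i f (x - y) := by
  have h1 := (hf.differentiable (by norm_num) (x - y)).hasFDerivAt.comp y
    ((hasFDerivAt_id y).const_sub x)
  rw [partialDeriv, show (fun t => f (x - t)) = f ∘ HSub.hSub x from rfl, h1.fderiv]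
  simp [partialDeriv]

theorem laplacian_comp_const_sub {f : EuclideanSpace ℝ (Fin n) → F} (hf : ContDiff ℝ 2 f)
    (x y : EuclideanSpace ℝ (Fin n)) :
    Laplacian.laplacian (fun t => f (x - t)) y = Laplacian.laplacian f (x - y) := by
  have hf' : ContDiff ℝ 2 fun t => f (x - t) := hf.comp (contDiff_const.sub contDiff_id)
  rw [laplacian_eq_sum_partialDeriv hf', laplacian_eq_sum_partialDeriv hf]
  refine Finset.sum_congr rfl fun i _ => ?_
  have : partialDeriv i (fun t => f (x - t)) = fun t => (-partialDeriv i f) (x - t) := by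
    ext t; rw [partialDeriv_comp_const_sub (hf.of_le (by norm_num))]; rfl
  rw [this, partialDeriv_comp_const_sub (f := -partialDeriv i f)
    (contDiff_partialDeriv hf (by norm_num) i).neg]
  rw [partialDeriv, fderiv_neg]
  exact neg_neg _

theorem partialDeriv_convolution_left {ρ : EuclideanSpace ℝ (Fin n) → ℝ}
    {h : EuclideanSpace ℝ (Fin n) → F} (hρ : ContDiff ℝ 1 ρ) (hρc : HasCompactSupport ρ)
    (hh : LocallyIntegrable h) (i : Fin n) :
    partialDeriv i (ρ ⋆[lsmul ℝ ℝ, volume] h) = partialDeriv i ρ ⋆[lsmul ℝ ℝ, volume] h := by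
  ext x
  rw [partialDeriv, ← convolution_flip,
    (hρc.hasFDerivAt_convolution_right (lsmul ℝ ℝ).flip hh hρ x).fderiv,
    convolution_precompR_apply _ hh (hρc.fderiv ℝ) (hρ.continuous_fderiv (by norm_num)),
    convolution_flip]
  rfl

theorem partialDeriv_convolution_right {ρ : EuclideanSpace ℝ (Fin n) → ℝ}
    {h : EuclideanSpace ℝ (Fin n) → F} (hρ : LocallyIntegrable ρ)
    (hh : ContDiff ℝ 1 h) (hhc : HasCompactSupport h) (i : Fin n) :
    partialDeriv i (ρ ⋆[lsmul ℝ ℝ, volume] h) = ρ ⋆[lsmul ℝ ℝ, volume] partialDeriv i h := by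
  ext x
  rw [partialDeriv, (hhc.hasFDerivAt_convolution_right (lsmul ℝ ℝ) hρ hh x).fderiv,
    convolution_precompR_apply _ hρ (hhc.fderiv ℝ) (hh.continuous_fderiv (by norm_num))]
  rfl

theorem continuous_laplacian {f : EuclideanSpace ℝ (Fin n) → F} (hf : ContDiff ℝ 2 f) :
    Continuous (Laplacian.laplacian f) := by
  rw [show Laplacian.laplacian f = fun x => ∑ i, partialDeriv i (partialDeriv i f) x from
    funext (laplacian_eq_sum_partialDeriv hf)]
  exact continuous_finsetSum _ fun i _ => (contDiff_partialDeriv (k := 0)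
    (contDiff_partialDeriv (k := 1) hf (by norm_num) i) (by norm_num) i).continuous

theorem laplacian_eq_zero_of_notMem_tsupport {f : EuclideanSpace ℝ (Fin n) → F}
    {x : EuclideanSpace ℝ (Fin n)} (hx : x ∉ tsupport f) : Laplacian.laplacian f x = 0 := by
  rw [(InnerProductSpace.laplacian_congr_nhds (f₂ := fun _ => (0 : F))
    (notMem_tsupport_iff_eventuallyEq.1 hx)).eq_of_nhds]
  exact congrFun InnerProductSpace.laplacian_const x

theorem hasCompactSupport_laplacian {f : EuclideanSpace ℝ (Fin n) → F}
    (hf : HasCompactSupport f) : HasCompactSupport (Laplacian.laplacian f) :=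
  HasCompactSupport.intro hf fun _ hx => laplacian_eq_zero_of_notMem_tsupport hx

/-- All derivatives fall on the kernel. The right-hand side is written with `ρ (x - t)`, the form in
which the weak equation is tested. -/
theorem laplacian_convolution_left {ρ : EuclideanSpace ℝ (Fin n) → ℝ}
    {h : EuclideanSpace ℝ (Fin n) → F} (hρ : ContDiff ℝ ∞ ρ) (hρc : HasCompactSupport ρ)
    (hh : LocallyIntegrable h) (x : EuclideanSpace ℝ (Fin n)) :
    Laplacian.laplacian (ρ ⋆[lsmul ℝ ℝ, volume] h) x =
      ∫ t, Laplacian.laplacian ρ (x - t) • h t := by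
  have h1 : ContDiff ℝ ∞ (ρ ⋆[lsmul ℝ ℝ, volume] h) :=
    hρc.contDiff_convolution_left _ hρ hh
  have hd : ∀ i, ContDiff ℝ (∞ : WithTop ℕ∞) (partialDeriv i ρ) := fun i =>
    contDiff_partialDeriv hρ (by simp) i
  have hdc : ∀ i, HasCompactSupport (partialDeriv i ρ) := fun i => hρc.fderiv_apply ℝ _
  have hdd : ∀ i, Continuous (partialDeriv i (partialDeriv i ρ)) := fun i =>
    (contDiff_partialDeriv (k := (∞ : WithTop ℕ∞)) (hd i) (by simp) i).continuous
  rw [laplacian_eq_sum_partialDeriv (h1.of_le two_le_infty)]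
  have h2 : ∀ i, partialDeriv i (partialDeriv i (ρ ⋆[lsmul ℝ ℝ, volume] h)) x =
      ∫ t, partialDeriv i (partialDeriv i ρ) (x - t) • h t := fun i => by
    rw [partialDeriv_convolution_left (hρ.of_le one_le_infty) hρc hh,
      partialDeriv_convolution_left ((hd i).of_le one_le_infty) (hdc i) hh,
      convolution_eq_swap]
    rfl
  rw [Finset.sum_congr rfl fun i _ => h2 i, ← integral_finsetSum]
  · refine integral_congr_ae (Eventually.of_forall fun t => ?_)
    simp only
    rw [laplacian_eq_sum_partialDeriv (hρ.of_le two_le_infty), Finset.sum_smul]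
  · intro i _
    refine hh.integrable_smul_left_of_hasCompactSupport
      (g := fun t => partialDeriv i (partialDeriv i ρ) (x - t))
      ((hdd i).comp (continuous_const.sub continuous_id)) ?_
    exact ((hdc i).fderiv_apply ℝ (EuclideanSpace.single i 1)).comp_homeomorph
      (Homeomorph.subLeft x)

theorem integral_partialDeriv_eq_zero {f : EuclideanSpace ℝ (Fin n) → ℝ} (hf : ContDiff ℝ 1 f)
    (hfc : HasCompactSupport f) (i : Fin n) : ∫ x, partialDeriv i f x = 0 := by
  have h := integral_mul_fderiv_eq_neg_fderiv_mul_of_integrable (μ := volume)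
    (f := fun _ : EuclideanSpace ℝ (Fin n) => (1 : ℝ)) (g := f)
    (v := EuclideanSpace.single i 1) (by simp) ?_ ?_ ?_ ?_
  · simpa [partialDeriv] using h
  · simp only [one_mul]
    exact (contDiff_partialDeriv (k := 0) hf (by norm_num)
      i).continuous.integrable_of_hasCompactSupport (hfc.fderiv_apply ℝ _)
  · simpa using hf.continuous.integrable_of_hasCompactSupport hfc
  · exact fun _ _ => differentiableAt_const _
  · exact fun x _ => hf.differentiable (by norm_num) x

theorem partialDeriv_mul {𝔸 : Type*} [NormedCommRing 𝔸] [NormedAlgebra ℝ 𝔸]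
    {f g : EuclideanSpace ℝ (Fin n) → 𝔸} (hf : ContDiff ℝ 1 f) (hg : ContDiff ℝ 1 g) (i : Fin n) :
    partialDeriv i (fun x => f x * g x) =
      fun x => f x * partialDeriv i g x + partialDeriv i f x * g x := by
  ext x
  rw [partialDeriv, fderiv_fun_mul (hf.differentiable (by norm_num) x)
    (hg.differentiable (by norm_num) x)]
  simp [partialDeriv, mul_comm]

theorem partialDeriv_add {f g : EuclideanSpace ℝ (Fin n) → F} (hf : ContDiff ℝ 1 f)
    (hg : ContDiff ℝ 1 g) (i : Fin n) :
    partialDeriv i (fun x => f x + g x) = fun x => partialDeriv i f x + partialDeriv i g x := by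
  ext x
  rw [partialDeriv, fderiv_fun_add (hf.differentiable (by norm_num) x)
    (hg.differentiable (by norm_num) x)]
  rfl

theorem partialDeriv_clm_comp {F' : Type*} [NormedAddCommGroup F'] [NormedSpace ℝ F']
    {f : EuclideanSpace ℝ (Fin n) → F} (hf : ContDiff ℝ 1 f) (l : F →L[ℝ] F') (i : Fin n) :
    partialDeriv i (fun x => l (f x)) = fun x => l (partialDeriv i f x) := by
  ext x
  have := l.hasFDerivAt.comp x (hf.differentiable (by norm_num) x).hasFDerivAt
  rw [partialDeriv, show (fun x => l (f x)) = l ∘ f from rfl, this.fderiv]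
  rfl

/-- The localization formula: the quadratic form of `-Δ` on `f u` for real `f`. -/
theorem re_integral_conj_mul_neg_laplacian {f : EuclideanSpace ℝ (Fin n) → ℝ}
    {u : EuclideanSpace ℝ (Fin n) → ℂ} (hf : ContDiff ℝ ∞ f) (hfc : HasCompactSupport f)
    (hu : ContDiff ℝ ∞ u) :
    ∫ x, (conj ((f x : ℂ) * u x) * -Laplacian.laplacian (fun y => (f y : ℂ) * u y) x).re =
      ∫ x, (‖gradient f x‖ ^ 2 * ‖u x‖ ^ 2 -
        f x ^ 2 * (conj (u x) * Laplacian.laplacian u x).re) := by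
  have hd : ∀ i, ContDiff ℝ (∞ : WithTop ℕ∞) (partialDeriv i f) := fun i => contDiff_partialDeriv hf (by simp) i
  have hud : ∀ i, ContDiff ℝ (∞ : WithTop ℕ∞) (partialDeriv i u) := fun i => contDiff_partialDeriv hu (by simp) i
  set fc : EuclideanSpace ℝ (Fin n) → ℂ := fun x => (f x : ℂ) with hfcdef
  have hfcs : ContDiff ℝ ∞ fc := Complex.ofRealCLM.contDiff.comp hf
  have hpfc : ∀ i, partialDeriv i fc = fun x => ((partialDeriv i f x : ℝ) : ℂ) := fun i =>
    partialDeriv_clm_comp (hf.of_le one_le_infty) Complex.ofRealCLM i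
  have hppfc : ∀ i, partialDeriv i (partialDeriv i fc) =
      fun x => ((partialDeriv i (partialDeriv i f) x : ℝ) : ℂ) := fun i => by
    rw [hpfc]; exact partialDeriv_clm_comp ((hd i).of_le one_le_infty) Complex.ofRealCLM i
  have hfcd : ∀ i, ContDiff ℝ (∞ : WithTop ℕ∞) (partialDeriv i fc) := fun i =>
    contDiff_partialDeriv hfcs (by simp) i
  set N : EuclideanSpace ℝ (Fin n) → ℝ := fun x => (u x).re * (u x).re + (u x).im * (u x).im
    with hN
  have hre : ContDiff ℝ ∞ fun x => (u x).re := Complex.reCLM.contDiff.comp hu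
  have him : ContDiff ℝ ∞ fun x => (u x).im := Complex.imCLM.contDiff.comp hu
  have hNs : ContDiff ℝ ∞ N := (hre.mul hre).add (him.mul him)
  have hpre : ∀ i, partialDeriv i (fun x => (u x).re) = fun x => (partialDeriv i u x).re :=
    fun i => partialDeriv_clm_comp (hu.of_le one_le_infty) Complex.reCLM i
  have hpim : ∀ i, partialDeriv i (fun x => (u x).im) = fun x => (partialDeriv i u x).im :=
    fun i => partialDeriv_clm_comp (hu.of_le one_le_infty) Complex.imCLM i
  have hpN : ∀ i x, partialDeriv i N x =
      2 * ((u x).re * (partialDeriv i u x).re + (u x).im * (partialDeriv i u x).im) := by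
    intro i x
    rw [hN, partialDeriv_add ((hre.mul hre).of_le one_le_infty) ((him.mul him).of_le one_le_infty),
      partialDeriv_mul (hre.of_le one_le_infty) (hre.of_le one_le_infty),
      partialDeriv_mul (him.of_le one_le_infty) (him.of_le one_le_infty), hpre, hpim]
    ring
  -- The vector field `f |u|² ∇f`. The two integrands of the formula differ pointwise by its
  -- divergence, which integrates to zero because `f` has compact support.
  set J : Fin n → EuclideanSpace ℝ (Fin n) → ℝ := fun i x => f x * (N x * partialDeriv i f x)
    with hJ
  have hJs : ∀ i, ContDiff ℝ ∞ (J i) := fun i => hf.mul (hNs.mul (hd i))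
  have hJc : ∀ i, HasCompactSupport (J i) := fun i => hfc.mul_right
  have hpJ : ∀ i x, partialDeriv i (J i) x = f x * (N x * partialDeriv i (partialDeriv i f) x +
      partialDeriv i N x * partialDeriv i f x) + partialDeriv i f x * (N x * partialDeriv i f x) := by
    intro i x
    rw [hJ, partialDeriv_mul (hf.of_le one_le_infty) ((hNs.mul (hd i)).of_le one_le_infty),
      partialDeriv_mul (hNs.of_le one_le_infty) ((hd i).of_le one_le_infty)]
  have hprod : ∀ i x, partialDeriv i (partialDeriv i fun y => fc y * u y) x =
      fc x * partialDeriv i (partialDeriv i u) x +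
        2 * ((partialDeriv i f x : ℝ) : ℂ) * partialDeriv i u x +
        ((partialDeriv i (partialDeriv i f) x : ℝ) : ℂ) * u x := by
    intro i x
    rw [partialDeriv_mul (hfcs.of_le one_le_infty) (hu.of_le one_le_infty),
      partialDeriv_add ((hfcs.mul (hud i)).of_le one_le_infty) (((hfcd i).mul hu).of_le one_le_infty),
      partialDeriv_mul (hfcs.of_le one_le_infty) ((hud i).of_le one_le_infty),
      partialDeriv_mul ((hfcd i).of_le one_le_infty) (hu.of_le one_le_infty), hppfc, hpfc]
    ring
  have hpt : ∀ x, (conj (fc x * u x) * -Laplacian.laplacian (fun y => fc y * u y) x).re =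
      (‖gradient f x‖ ^ 2 * ‖u x‖ ^ 2 - f x ^ 2 * (conj (u x) * Laplacian.laplacian u x).re) -
        ∑ i, partialDeriv i (J i) x := by
    intro x
    rw [laplacian_eq_sum_partialDeriv ((hfcs.mul hu).of_le two_le_infty),
      laplacian_eq_sum_partialDeriv (hu.of_le two_le_infty), norm_gradient_sq_eq_sum, Finset.sum_mul,
      Finset.mul_sum, Complex.re_sum, Finset.mul_sum, ← Finset.sum_sub_distrib,
      ← Finset.sum_sub_distrib, ← Finset.sum_neg_distrib, Finset.mul_sum, Complex.re_sum]
    refine Finset.sum_congr rfl fun i _ => ?_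
    rw [hprod, hpJ, hpN, ← Complex.normSq_eq_norm_sq, Complex.normSq_apply, hN]
    simp only [hfcdef, Complex.mul_re, Complex.mul_im, Complex.neg_re, Complex.neg_im,
      Complex.add_re, Complex.add_im, Complex.conj_re, Complex.conj_im, Complex.ofReal_re,
      Complex.ofReal_im, Complex.re_ofNat, Complex.im_ofNat, map_mul, Complex.conj_ofReal]
    ring
  have hJi : ∀ i, Integrable (partialDeriv i (J i)) := fun i =>
    (contDiff_partialDeriv (k := (∞ : WithTop ℕ∞)) (hJs i) (by simp) i).continuous.integrable_of_hasCompactSupport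
      ((hJc i).fderiv_apply ℝ _)
  rw [integral_congr_ae (Eventually.of_forall hpt), integral_sub, integral_finsetSum]
  · simp_rw [integral_partialDeriv_eq_zero ((hJs _).of_le one_le_infty) (hJc _)]
    simp
  · exact fun i _ => hJi i
  · refine Continuous.integrable_of_hasCompactSupport ?_ ?_
    · simp_rw [norm_gradient_sq_eq_sum]
      have h1 := continuous_laplacian (hu.of_le two_le_infty)
      have h2 := fun i => (hd i).continuous
      have h3 := hu.continuous
      have h4 := hf.continuous
      fun_prop
    · refine HasCompactSupport.intro hfc fun x hx => ?_
      rw [norm_gradient_sq_eq_sum, image_eq_zero_of_notMem_tsupport hx]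
      simp [partialDeriv_eq_zero_of_notMem_tsupport _ hx]
  · exact integrable_finsetSum _ fun i _ => hJi i

end Agmon

/-! ### The localized inequality for a weak solution -/

namespace Agmon

open scoped Convolution Topology
open ContinuousLinearMap (lsmul)

variable {n : ℕ}

/-- Truncated to a compact set, the potential becomes a multiplier that is bounded on `L²` of the
whole space. -/
theorem memLp_indicator_potential_mul {Ω : Opens (EuclideanSpace ℝ (Fin n))}
    {V : EuclideanSpace ℝ (Fin n) → ℝ} (hV : MemLinftyLoc Ω V) (E : ℝ)
    {K : Set (EuclideanSpace ℝ (Fin n))} (hK : IsCompact K) (hKΩ : K ⊆ Ω) :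
    AEStronglyMeasurable (K.indicator fun y => V y - E) ∧
      ∃ M, ∀ᵐ x, ‖K.indicator (fun y => V y - E) x‖ ≤ M := by
  have : IsFiniteMeasure (volume.restrict K) :=
    isFiniteMeasure_restrict.2 (hK.measure_lt_top (μ := volume)).ne
  have h1 : MemLp (fun y => V y - E) ∞ (volume.restrict K) := (hV K hK hKΩ).sub (memLp_const E)
  refine ⟨(aestronglyMeasurable_indicator_iff hK.measurableSet).2 h1.1, ?_⟩
  obtain ⟨M, hM⟩ := (memLp_indicator_iff_restrict hK.measurableSet).2 h1
    |>.2.ne |> fun h => eLpNormEssSup_lt_top_iff_isBoundedUnder.1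
      (lt_top_iff_ne_top.2 (by rwa [eLpNorm_exponent_top] at h))
  refine ⟨M, ?_⟩
  filter_upwards [hM] with x hx
  exact_mod_cast hx

/-- The weak equation is tested with `y ↦ ρ (x - y)`, which is supported in `K ⊆ Ω`; truncating the
potential to `K` is therefore harmless. -/
theorem laplacian_convolution_eq_of_isWeakSolution {Ω : Opens (EuclideanSpace ℝ (Fin n))}
    {V : EuclideanSpace ℝ (Fin n) → ℝ} (hV : MemLinftyLoc Ω V) {E : ℝ}
    {ψ : EuclideanSpace ℝ (Fin n) → ℂ} (hψL2 : MemLp ψ 2 (volume.restrict Ω))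
    (hψ : ∀ φ : 𝓓(Ω, ℂ), pairing Ω ψ (fun x => schrodinger Ω V φ x - (E : ℂ) * φ x) = 0)
    {K : Set (EuclideanSpace ℝ (Fin n))} (hK : IsCompact K) (hKΩ : K ⊆ Ω)
    (φ : ContDiffBump (0 : EuclideanSpace ℝ (Fin n))) {x : EuclideanSpace ℝ (Fin n)}
    (hx : Metric.closedBall x φ.rOut ⊆ K) :
    Laplacian.laplacian (φ.normed volume ⋆[lsmul ℝ ℝ, volume] (Ω : Set _).indicator ψ) x =
      (φ.normed volume ⋆[lsmul ℝ ℝ, volume] fun y =>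
        ((K.indicator (fun y => V y - E) y : ℝ) : ℂ) * (Ω : Set _).indicator ψ y) x := by
  set ρ : EuclideanSpace ℝ (Fin n) → ℝ := φ.normed volume with hρdef
  set ψ₀ := (Ω : Set (EuclideanSpace ℝ (Fin n))).indicator ψ with hψ₀
  set Q : EuclideanSpace ℝ (Fin n) → ℝ := K.indicator (fun y => V y - E) with hQ
  have hρ : ContDiff ℝ (⊤ : ℕ∞) ρ := φ.contDiff_normed
  have hρc : HasCompactSupport ρ := φ.hasCompactSupport_normed
  have hΩm : MeasurableSet (Ω : Set (EuclideanSpace ℝ (Fin n))) := Ω.isOpen.measurableSet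
  have hψ₀L : MemLp ψ₀ 2 := (memLp_indicator_iff_restrict hΩm).2 hψL2
  obtain ⟨hQm, M, hQM⟩ := memLp_indicator_potential_mul hV E hK hKΩ
  have hQL : MemLp (fun y => (Q y : ℂ) * ψ₀ y) 2 :=
    hψ₀L.of_le_mul (c := M) ((Complex.continuous_ofReal.comp_aestronglyMeasurable hQm).mul hψ₀L.1)
      (hQM.mono fun y hy => by
        rw [norm_mul, Complex.norm_real]
        exact mul_le_mul_of_nonneg_right hy (norm_nonneg _))
  have hψ₀loc : LocallyIntegrable ψ₀ := hψ₀L.locallyIntegrable (by norm_num)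
  have hQloc : LocallyIntegrable (fun y => (Q y : ℂ) * ψ₀ y) :=
    hQL.locallyIntegrable (by norm_num)
  set θ : EuclideanSpace ℝ (Fin n) → ℝ := fun y => ρ (x - y) with hθ
  have hθs : ContDiff ℝ (⊤ : ℕ∞) θ := hρ.comp (contDiff_const.sub contDiff_id)
  have hθ0 : ∀ y ∉ K, θ y = 0 := by
    intro y hy
    by_contra hne
    have : x - y ∈ Function.support ρ := hne
    rw [hρdef, φ.support_normed_eq, mem_ball_zero_iff, ← dist_eq_norm, dist_comm] at this
    exact hy (hx (Metric.mem_closedBall.2 this.le))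
  have hθc : HasCompactSupport θ := HasCompactSupport.intro hK hθ0
  have hΘs : ContDiff ℝ (⊤ : ℕ∞) fun y => (θ y : ℂ) := Complex.ofRealCLM.contDiff.comp hθs
  have hΘt : tsupport (fun y => (θ y : ℂ)) ⊆ K :=
    closure_minimal (fun y hy => by
      by_contra h
      exact hy (by simp [hθ0 y h])) hK.isClosed
  let Θ : 𝓓(Ω, ℂ) := ⟨fun y => (θ y : ℂ), hΘs, HasCompactSupport.intro hK fun y hy => by
    simp [hθ0 y hy], hΘt.trans hKΩ⟩
  have hΘcoe : (Θ : EuclideanSpace ℝ (Fin n) → ℂ) = fun y => (θ y : ℂ) := rfl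
  have hlap : ∀ y, Laplacian.laplacian (Θ : EuclideanSpace ℝ (Fin n) → ℂ) y =
      ((Laplacian.laplacian ρ (x - y) : ℝ) : ℂ) := by
    intro y
    rw [hΘcoe, ← laplacian_comp_const_sub (hρ.of_le two_le_infty)]
    exact ContDiffAt.laplacian_CLM_comp_left (l := Complex.ofRealCLM)
      (hθs.of_le two_le_infty).contDiffAt
  have hlc : Continuous fun y => Laplacian.laplacian ρ (x - y) :=
    (continuous_laplacian (hρ.of_le two_le_infty)).comp (continuous_const.sub continuous_id)
  have hls : HasCompactSupport fun y => Laplacian.laplacian ρ (x - y) :=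
    (hasCompactSupport_laplacian hρc).comp_homeomorph (Homeomorph.subLeft x)
  have hi1 : Integrable fun t => Laplacian.laplacian ρ (x - t) • ψ₀ t :=
    hψ₀loc.integrable_smul_left_of_hasCompactSupport hlc hls
  have hi2 : Integrable fun t => θ t • ((Q t : ℂ) * ψ₀ t) :=
    hQloc.integrable_smul_left_of_hasCompactSupport hθs.continuous hθc
  have hw : ∫ t, (θ t • ((Q t : ℂ) * ψ₀ t) - Laplacian.laplacian ρ (x - t) • ψ₀ t) = 0 := by
    -- `pairing` conjugates its first argument. Conjugating the equation restores `ψ` and leaves the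
    -- real `θ` and `V` unchanged.
    have h1 := congrArg conj (hψ Θ)
    rw [pairing, map_zero, ← integral_conj, ← integral_indicator hΩm] at h1
    rw [← h1]
    refine integral_congr_ae (Eventually.of_forall fun t => ?_)
    by_cases ht : t ∈ (Ω : Set (EuclideanSpace ℝ (Fin n)))
    · simp only [indicator_of_mem ht, schrodinger, hlap]
      rw [hψ₀, indicator_of_mem ht]
      simp only [hΘcoe, map_mul, map_sub, map_add, map_neg, Complex.conj_conj, Complex.conj_ofReal,
        Complex.real_smul]
      by_cases htK : t ∈ K
      · rw [hQ, indicator_of_mem htK]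
        push_cast
        ring
      · rw [hθ0 t htK]
        push_cast
        ring
    · simp only [indicator_of_notMem ht]
      rw [hψ₀, indicator_of_notMem ht]
      simp
  rw [integral_sub hi2 hi1, sub_eq_zero] at hw
  rw [laplacian_convolution_left hρ hρc hψ₀loc, ← hw, convolution_eq_swap]
  rfl

/-- Continuity needs checking only on the support of the product, which lies in `U`; the values of
`γ` elsewhere play no role. -/
theorem continuous_mul_of_tsupport_subset {α : Type*} [TopologicalSpace α] {U : Set α}
    (hU : IsOpen U) {f γ : α → ℝ} (hf : Continuous f) (hfU : tsupport f ⊆ U)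
    (hγ : ContinuousOn γ U) : Continuous fun x => γ x * f x ^ 2 := by
  refine continuous_of_tsupport fun x hx => ?_
  have hsub : Function.support (fun x => γ x * f x ^ 2) ⊆ Function.support f :=
    fun y hy h => hy (by simp [h])
  have hxU : x ∈ U := hfU (closure_mono hsub hx)
  exact (hγ.continuousAt (hU.mem_nhds hxU)).mul (hf.continuousAt.pow 2)

theorem continuous_localization_weight {U : Set (EuclideanSpace ℝ (Fin n))} (hU : IsOpen U)
    {f γ : EuclideanSpace ℝ (Fin n) → ℝ} (hf : ContDiff ℝ 1 f) (hfU : tsupport f ⊆ U)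
    (hγ : ContinuousOn γ U) (c : ℝ) :
    Continuous fun x => ‖gradient f x‖ ^ 2 - (γ x + c) * f x ^ 2 := by
  have h1 := continuous_mul_of_tsupport_subset hU hf.continuous hfU
    (hγ.add continuousOn_const (g := fun _ => c))
  have h2 : Continuous fun x => ‖gradient f x‖ ^ 2 := by
    simp_rw [norm_gradient_sq_eq_sum]
    have := fun i => (contDiff_partialDeriv (k := 0) hf (by simp) i).continuous
    fun_prop
  exact h2.sub h1

/-- The positivity hypothesis is applied to `f u_j`, with `u_j` the mollified solution, and `j → ∞`.
The potential then cancels against `Δu_j`. -/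
theorem integral_localized_nonneg_of_smooth {Ω : Opens (EuclideanSpace ℝ (Fin n))}
    {V : EuclideanSpace ℝ (Fin n) → ℝ} (hV : MemLinftyLoc Ω V) {E c : ℝ}
    {γ : EuclideanSpace ℝ (Fin n) → ℝ} (hγ : ContinuousOn γ Ω)
    (hA : ∀ φ : 𝓓(Ω, ℂ), c * ∫ x in Ω, ‖φ x‖ ^ 2 ≤
      (pairing Ω φ (fun x => schrodinger Ω V φ x - (E : ℂ) * φ x)).re
        - ∫ x in Ω, γ x * ‖φ x‖ ^ 2)
    {ψ : EuclideanSpace ℝ (Fin n) → ℂ} (hψL2 : MemLp ψ 2 (volume.restrict Ω))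
    (hψ : ∀ φ : 𝓓(Ω, ℂ), pairing Ω ψ (fun x => schrodinger Ω V φ x - (E : ℂ) * φ x) = 0)
    {f : EuclideanSpace ℝ (Fin n) → ℝ} (hf : ContDiff ℝ (⊤ : ℕ∞) f) (hfc : HasCompactSupport f)
    (hfΩ : tsupport f ⊆ Ω) :
    0 ≤ ∫ x, (‖gradient f x‖ ^ 2 - (γ x + c) * f x ^ 2) *
      ‖(Ω : Set (EuclideanSpace ℝ (Fin n))).indicator ψ x‖ ^ 2 := by
  set ψ₀ := (Ω : Set (EuclideanSpace ℝ (Fin n))).indicator ψ with hψ₀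
  have hΩm : MeasurableSet (Ω : Set (EuclideanSpace ℝ (Fin n))) := Ω.isOpen.measurableSet
  have hψ₀L : MemLp ψ₀ 2 := (memLp_indicator_iff_restrict hΩm).2 hψL2
  have hψ₀loc : LocallyIntegrable ψ₀ := hψ₀L.locallyIntegrable (by norm_num)
  obtain ⟨r, hr, hrΩ⟩ := IsCompact.exists_cthickening_subset_open hfc Ω.isOpen hfΩ
  -- The margin `r` keeps the mollification balls around points of `tsupport f` inside `K`.
  set K := Metric.cthickening r (tsupport f) with hKdef
  have hK : IsCompact K := IsCompact.cthickening hfc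
  set Q : EuclideanSpace ℝ (Fin n) → ℝ := K.indicator (fun y => V y - E) with hQ
  obtain ⟨hQm, M, hQM⟩ := memLp_indicator_potential_mul hV E hK hrΩ
  set h : EuclideanSpace ℝ (Fin n) → ℂ := fun y => (Q y : ℂ) * ψ₀ y with hh
  have hhL : MemLp h 2 :=
    hψ₀L.of_le_mul (c := M) ((Complex.continuous_ofReal.comp_aestronglyMeasurable hQm).mul hψ₀L.1)
      (hQM.mono fun y hy => by
        rw [norm_mul, Complex.norm_real]
        exact mul_le_mul_of_nonneg_right hy (norm_nonneg _))
  obtain ⟨φ, hφ⟩ := exists_contDiffBump_tendsto_rOut (EuclideanSpace ℝ (Fin n))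
  set u : ℕ → EuclideanSpace ℝ (Fin n) → ℂ := fun j =>
    (φ j).normed volume ⋆[lsmul ℝ ℝ, volume] ψ₀ with hu
  set w : ℕ → EuclideanSpace ℝ (Fin n) → ℂ := fun j =>
    (φ j).normed volume ⋆[lsmul ℝ ℝ, volume] h with hw
  have hus : ∀ j, ContDiff ℝ (⊤ : ℕ∞) (u j) := fun j =>
    (φ j).hasCompactSupport_normed.contDiff_convolution_left _ (φ j).contDiff_normed hψ₀loc
  have hconvL : ∀ {v : EuclideanSpace ℝ (Fin n) → ℂ}, MemLp v 2 → ∀ j,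
      MemLp ((φ j).normed volume ⋆[lsmul ℝ ℝ, volume] v) 2 := fun hv j =>
    ⟨((φ j).hasCompactSupport_normed.continuous_convolution_left _ (φ j).continuous_normed
      (hv.locallyIntegrable (by norm_num))).aestronglyMeasurable,
      (eLpNorm_normed_convolution_le _ hv.1).trans_lt hv.2⟩
  have huL : ∀ j, MemLp (u j) 2 := hconvL hψ₀L
  have hwL : ∀ j, MemLp (w j) 2 := hconvL hhL
  set A : EuclideanSpace ℝ (Fin n) → ℝ := fun x => ‖gradient f x‖ ^ 2 - (γ x + c) * f x ^ 2
    with hAdef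
  have hAc : Continuous A :=
    continuous_localization_weight Ω.isOpen (hf.of_le one_le_infty) hfΩ hγ c
  have hAs : HasCompactSupport A := HasCompactSupport.intro hfc fun x hx => by
    rw [hAdef]
    simp only
    rw [norm_gradient_sq_eq_sum, image_eq_zero_of_notMem_tsupport hx]
    simp [partialDeriv_eq_zero_of_notMem_tsupport _ hx]
  have hf2c : Continuous fun x => f x ^ 2 := hf.continuous.pow 2
  have hf2s : HasCompactSupport fun x => f x ^ 2 := by
    simp_rw [pow_two]; exact hfc.mul_right
  obtain ⟨M₁, hM₁⟩ := hAc.bounded_above_of_compact_support hAs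
  obtain ⟨M₂, hM₂⟩ := hf2c.bounded_above_of_compact_support hf2s
  have hlim : ∀ {a : EuclideanSpace ℝ (Fin n) → ℝ} {B : ℝ} {v₁ v₂ : EuclideanSpace ℝ (Fin n) → ℂ},
      AEStronglyMeasurable a → (∀ᵐ x, ‖a x‖ ≤ B) → MemLp v₁ 2 → MemLp v₂ 2 →
      Tendsto (fun j => (∫ x, (a x : ℂ) *
        (conj (((φ j).normed volume ⋆[lsmul ℝ ℝ, volume] v₁) x) *
          ((φ j).normed volume ⋆[lsmul ℝ ℝ, volume] v₂) x)).re) atTop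
        (𝓝 (∫ x, (a x : ℂ) * (conj (v₁ x) * v₂ x)).re) := by
    intro a B v₁ v₂ ha hB h₁ h₂
    exact (Complex.continuous_re.tendsto _).comp (tendsto_integral_mul_conj_mul (M := B)
      (Complex.continuous_ofReal.comp_aestronglyMeasurable ha)
      (hB.mono fun x hx => by rwa [Complex.norm_real]) h₁ h₂
      (hconvL h₁) (hconvL h₂) (tendsto_eLpNorm_normed_convolution_sub hφ h₁)
      (tendsto_eLpNorm_normed_convolution_sub hφ h₂))
  have hQ2m : AEStronglyMeasurable fun x => f x ^ 2 * Q x :=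
    hf2c.aestronglyMeasurable.mul hQm
  have hQ2b : ∀ᵐ x, ‖f x ^ 2 * Q x‖ ≤ M₂ * M := by
    filter_upwards [hQM] with x hx
    rw [norm_mul]
    exact mul_le_mul (hM₂ x) hx (norm_nonneg _) ((norm_nonneg _).trans (hM₂ x))
  have T1 := hlim hAc.aestronglyMeasurable (Eventually.of_forall hM₁) hψ₀L hψ₀L
  have T2 := hlim hf2c.aestronglyMeasurable (Eventually.of_forall hM₂) hψ₀L hhL
  have T3 := hlim hQ2m hQ2b hψ₀L hψ₀L
  -- At finite `j` the last two terms do not cancel: `w j` mollifies the product `Q ψ₀`, whereas the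
  -- potential in the quadratic form multiplies `u j`. Their limits coincide.
  have key : ∀ᶠ j in atTop, 0 ≤ (∫ x, (A x : ℂ) * (conj (u j x) * u j x)).re -
      (∫ x, ((f x ^ 2 : ℝ) : ℂ) * (conj (u j x) * w j x)).re +
      (∫ x, ((f x ^ 2 * Q x : ℝ) : ℂ) * (conj (u j x) * u j x)).re := by
    filter_upwards [hφ.eventually (ge_mem_nhds hr)] with j hj
    have hcs : HasCompactSupport fun x => (f x : ℂ) * u j x :=
      HasCompactSupport.intro hfc fun x hx => by simp [image_eq_zero_of_notMem_tsupport hx]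
    have hts : tsupport (fun x => (f x : ℂ) * u j x) ⊆ tsupport f :=
      closure_mono fun x hx h => hx (by simp [h])
    have hfs : ContDiff ℝ (⊤ : ℕ∞) fun x => (f x : ℂ) * u j x :=
      (Complex.ofRealCLM.contDiff.comp hf).mul (hus j)
    let Φ : 𝓓(Ω, ℂ) := ⟨fun x => (f x : ℂ) * u j x, hfs, hcs, hts.trans hfΩ⟩
    have hΦ : (Φ : EuclideanSpace ℝ (Fin n) → ℂ) = fun x => (f x : ℂ) * u j x := rfl
    have hfz : ∀ x ∉ (Ω : Set (EuclideanSpace ℝ (Fin n))), f x = 0 := fun x hx =>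
      image_eq_zero_of_notMem_tsupport fun hx' => hx (hfΩ hx')
    have hΔ : ∀ x, f x ^ 2 * (conj (u j x) * Laplacian.laplacian (u j) x).re =
        f x ^ 2 * (conj (u j x) * w j x).re := by
      intro x
      by_cases hx : x ∈ tsupport f
      · rw [hu]
        simp only
        rw [laplacian_convolution_eq_of_isWeakSolution hV hψL2 hψ hK hrΩ (φ j)]
        exact fun y hy => Metric.mem_cthickening_of_dist_le y x r _ hx
          ((Metric.mem_closedBall.1 hy).trans hj)
      · simp [image_eq_zero_of_notMem_tsupport hx]
    have hbil : ∀ {a : EuclideanSpace ℝ (Fin n) → ℝ} {B : ℝ}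
        {v₁ v₂ : EuclideanSpace ℝ (Fin n) → ℂ}, AEStronglyMeasurable a → (∀ᵐ x, ‖a x‖ ≤ B) →
        MemLp v₁ 2 → MemLp v₂ 2 → Integrable fun x => (a x : ℂ) * (conj (v₁ x) * v₂ x) := by
      intro a B v₁ v₂ ha hB h₁ h₂
      have h3 : Integrable fun x => conj (v₁ x) * v₂ x := h₁.star.integrable_mul h₂
      exact h3.bdd_mul (c := B) (Complex.continuous_ofReal.comp_aestronglyMeasurable ha)
        (hB.mono fun x hx => by rwa [Complex.norm_real])
    have hre : ∀ {v : EuclideanSpace ℝ (Fin n) → ℂ}, Integrable v →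
        (∫ x, v x).re = ∫ x, (v x).re := fun hv => (integral_re hv).symm
    have I1 := hbil hAc.aestronglyMeasurable (Eventually.of_forall hM₁) (huL j) (huL j)
    have I2 := hbil hf2c.aestronglyMeasurable (Eventually.of_forall hM₂) (huL j) (hwL j)
    have I3 := hbil hQ2m hQ2b (huL j) (huL j)
    have hγc := continuous_mul_of_tsupport_subset Ω.isOpen hf.continuous hfΩ hγ
    have I4 : Integrable fun x => f x ^ 2 * ‖u j x‖ ^ 2 :=
      (hf2c.mul ((hus j).continuous.norm.pow 2)).integrable_of_hasCompactSupport hf2s.mul_right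
    have I5 : Integrable fun x => γ x * f x ^ 2 * ‖u j x‖ ^ 2 :=
      (hγc.mul ((hus j).continuous.norm.pow 2)).integrable_of_hasCompactSupport
        (HasCompactSupport.intro hfc fun x hx => by simp [image_eq_zero_of_notMem_tsupport hx])
    have hnorm : ∀ x, ‖Φ x‖ ^ 2 = f x ^ 2 * ‖u j x‖ ^ 2 := fun x => by
      rw [hΦ]; simp [mul_pow]
    have h0 := hA Φ
    have e1 : ∫ x in Ω, ‖Φ x‖ ^ 2 = ∫ x, f x ^ 2 * ‖u j x‖ ^ 2 := by
      simp_rw [hnorm]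
      exact setIntegral_eq_integral_of_forall_compl_eq_zero fun x hx => by simp [hfz x hx]
    have e2 : ∫ x in Ω, γ x * ‖Φ x‖ ^ 2 = ∫ x, γ x * f x ^ 2 * ‖u j x‖ ^ 2 := by
      simp_rw [hnorm, ← mul_assoc]
      exact setIntegral_eq_integral_of_forall_compl_eq_zero fun x hx => by simp [hfz x hx]
    have hD : Integrable fun x => conj ((f x : ℂ) * u j x) *
        -Laplacian.laplacian (fun y => (f y : ℂ) * u j y) x := by
      refine Continuous.integrable_of_hasCompactSupport ?_ ?_
      · exact (Complex.continuous_conj.comp hfs.continuous).mul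
          (continuous_laplacian (hfs.of_le two_le_infty)).neg
      · exact HasCompactSupport.intro hfc fun x hx => by
          simp [image_eq_zero_of_notMem_tsupport hx]
    have e3 : (pairing Ω Φ (fun x => schrodinger Ω V Φ x - (E : ℂ) * Φ x)).re =
        (∫ x, (‖gradient f x‖ ^ 2 * ‖u j x‖ ^ 2 - f x ^ 2 * (conj (u j x) * w j x).re)) +
          (∫ x, ((f x ^ 2 * Q x : ℝ) : ℂ) * (conj (u j x) * u j x)).re := by
      have hp : pairing Ω Φ (fun x => schrodinger Ω V Φ x - (E : ℂ) * Φ x) =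
          ∫ x, (conj ((f x : ℂ) * u j x) * -Laplacian.laplacian (fun y => (f y : ℂ) * u j y) x +
            ((f x ^ 2 * Q x : ℝ) : ℂ) * (conj (u j x) * u j x)) := by
        rw [pairing, setIntegral_eq_integral_of_forall_compl_eq_zero
          (fun x hx => by simp [hΦ, hfz x hx])]
        refine integral_congr_ae (Eventually.of_forall fun x => ?_)
        simp only [schrodinger, hΦ]
        by_cases hx : x ∈ tsupport f
        · have hxK : x ∈ K := Metric.self_subset_cthickening _ hx
          rw [hQ, indicator_of_mem hxK]
          simp only [map_mul, Complex.conj_ofReal]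
          push_cast
          ring
        · simp [image_eq_zero_of_notMem_tsupport hx]
      rw [hp, integral_add hD I3, Complex.add_re, hre hD,
        re_integral_conj_mul_neg_laplacian hf hfc (hus j)]
      simp_rw [hΔ]
    have IG : Integrable fun x => ‖gradient f x‖ ^ 2 * ‖u j x‖ ^ 2 := by
      refine Continuous.integrable_of_hasCompactSupport ?_ ?_
      · simp_rw [norm_gradient_sq_eq_sum]
        have h1 := fun i => (contDiff_partialDeriv (k := 0) hf (by simp) i).continuous
        have h2 := (hus j).continuous
        fun_prop
      · refine HasCompactSupport.intro hfc fun x hx => ?_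
        rw [norm_gradient_sq_eq_sum]
        simp [partialDeriv_eq_zero_of_notMem_tsupport _ hx]
    have I2r : Integrable fun x => f x ^ 2 * (conj (u j x) * w j x).re := by
      refine I2.re.congr (Eventually.of_forall fun x => ?_)
      exact Complex.re_ofReal_mul _ _
    have I6 : Integrable fun x => ‖gradient f x‖ ^ 2 * ‖u j x‖ ^ 2 -
        γ x * f x ^ 2 * ‖u j x‖ ^ 2 := IG.sub I5
    have e4 : (∫ x, (A x : ℂ) * (conj (u j x) * u j x)).re =
        (∫ x, ‖gradient f x‖ ^ 2 * ‖u j x‖ ^ 2) - (∫ x, γ x * f x ^ 2 * ‖u j x‖ ^ 2) -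
          c * ∫ x, f x ^ 2 * ‖u j x‖ ^ 2 := by
      rw [hre I1, ← integral_const_mul, ← integral_sub IG I5,
        ← integral_sub I6 (I4.const_mul c)]
      refine integral_congr_ae (Eventually.of_forall fun x => ?_)
      simp only [Complex.re_ofReal_mul, Complex.conj_mul', hAdef]
      norm_cast
      ring
    have e5 : (∫ x, ((f x ^ 2 : ℝ) : ℂ) * (conj (u j x) * w j x)).re =
        ∫ x, f x ^ 2 * (conj (u j x) * w j x).re := by
      rw [hre I2]
      exact integral_congr_ae (Eventually.of_forall fun x => Complex.re_ofReal_mul _ _)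
    rw [e1, e2, e3, integral_sub IG I2r] at h0
    rw [e4, e5]
    linarith
  have hfin := ge_of_tendsto ((T1.sub T2).add T3) key
  have h23 : ∫ x, ((f x ^ 2 : ℝ) : ℂ) * (conj (ψ₀ x) * h x) =
      ∫ x, ((f x ^ 2 * Q x : ℝ) : ℂ) * (conj (ψ₀ x) * ψ₀ x) := by
    refine integral_congr_ae (Eventually.of_forall fun x => ?_)
    simp only [hh]
    push_cast
    ring
  rw [h23, sub_add_cancel] at hfin
  have h1 : ∫ x, (A x : ℂ) * (conj (ψ₀ x) * ψ₀ x) = ((∫ x, A x * ‖ψ₀ x‖ ^ 2 : ℝ) : ℂ) := by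
    rw [← integral_complex_ofReal]
    refine integral_congr_ae (Eventually.of_forall fun x => ?_)
    simp only [Complex.conj_mul']
    push_cast
    rfl
  rw [h1, Complex.ofReal_re] at hfin
  exact hfin

/-- Mollifying `f` makes values and first derivatives converge pointwise, with uniform bounds and
supports in a fixed compact `K ⊆ Ω`; dominated convergence applies. -/
theorem integral_localized_nonneg {Ω : Opens (EuclideanSpace ℝ (Fin n))}
    {V : EuclideanSpace ℝ (Fin n) → ℝ} (hV : MemLinftyLoc Ω V) {E c : ℝ}
    {γ : EuclideanSpace ℝ (Fin n) → ℝ} (hγ : ContinuousOn γ Ω)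
    (hA : ∀ φ : 𝓓(Ω, ℂ), c * ∫ x in Ω, ‖φ x‖ ^ 2 ≤
      (pairing Ω φ (fun x => schrodinger Ω V φ x - (E : ℂ) * φ x)).re
        - ∫ x in Ω, γ x * ‖φ x‖ ^ 2)
    {ψ : EuclideanSpace ℝ (Fin n) → ℂ} (hψL2 : MemLp ψ 2 (volume.restrict Ω))
    (hψ : ∀ φ : 𝓓(Ω, ℂ), pairing Ω ψ (fun x => schrodinger Ω V φ x - (E : ℂ) * φ x) = 0)
    {f : EuclideanSpace ℝ (Fin n) → ℝ} (hf : ContDiff ℝ 1 f) (hfc : HasCompactSupport f)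
    (hfΩ : tsupport f ⊆ Ω) :
    0 ≤ ∫ x, (‖gradient f x‖ ^ 2 - (γ x + c) * f x ^ 2) *
      ‖(Ω : Set (EuclideanSpace ℝ (Fin n))).indicator ψ x‖ ^ 2 := by
  set ψ₀ := (Ω : Set (EuclideanSpace ℝ (Fin n))).indicator ψ with hψ₀
  have hψ₀L : MemLp ψ₀ 2 := (memLp_indicator_iff_restrict Ω.isOpen.measurableSet).2 hψL2
  obtain ⟨r, hr, hrΩ⟩ := IsCompact.exists_cthickening_subset_open hfc Ω.isOpen hfΩ
  set K := Metric.cthickening r (tsupport f) with hKdef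
  have hK : IsCompact K := IsCompact.cthickening hfc
  obtain ⟨φ, hφ⟩ := exists_contDiffBump_tendsto_rOut (EuclideanSpace ℝ (Fin n))
  set F : ℕ → EuclideanSpace ℝ (Fin n) → ℝ := fun j =>
    (φ j).normed volume ⋆[lsmul ℝ ℝ, volume] f with hF
  have hFs : ∀ j, ContDiff ℝ (⊤ : ℕ∞) (F j) := fun j =>
    (φ j).hasCompactSupport_normed.contDiff_convolution_left _ (φ j).contDiff_normed
      hf.continuous.locallyIntegrable
  have hFd : ∀ j i, partialDeriv i (F j) =
      (φ j).normed volume ⋆[lsmul ℝ ℝ, volume] partialDeriv i f := fun j i =>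
    partialDeriv_convolution_right (φ j).continuous_normed.locallyIntegrable hf hfc i
  have hdc : ∀ i, Continuous (partialDeriv i f) := fun i =>
    (contDiff_partialDeriv (k := 0) hf (by norm_num) i).continuous
  have hbound : ∀ {v : EuclideanSpace ℝ (Fin n) → ℝ} {B : ℝ}, Continuous v → (∀ x, ‖v x‖ ≤ B) →
      ∀ j x, ‖((φ j).normed volume ⋆[lsmul ℝ ℝ, volume] v) x‖ ≤ B := by
    intro v B hv hB j x
    have := dist_convolution_le (f := (φ j).normed volume) (x₀ := x) (z₀ := (0 : ℝ))
      ((norm_nonneg _).trans (hB x)) (φ j).support_normed_eq.subset (φ j).nonneg_normed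
      (φ j).integral_normed hv.aestronglyMeasurable fun y _ => by rw [dist_zero_right]; exact hB y
    rwa [dist_zero_right] at this
  have hzero : ∀ {v : EuclideanSpace ℝ (Fin n) → ℝ}, (∀ x ∉ tsupport f, v x = 0) →
      ∀ j, (φ j).rOut ≤ r → ∀ x ∉ K, ((φ j).normed volume ⋆[lsmul ℝ ℝ, volume] v) x = 0 := by
    intro v hv j hj x hx
    have hxy : ∀ y ∈ Metric.ball x (φ j).rOut, v y = 0 := by
      intro y hy
      refine hv y fun hyt => hx (Metric.mem_cthickening_of_dist_le x y r _ hyt ?_)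
      rw [dist_comm]
      exact (Metric.mem_ball.1 hy).le.trans hj
    have hx0 := hxy x (Metric.mem_ball_self (φ j).rOut_pos)
    rw [ContDiffBump.normed_convolution_eq_right, hx0]
    intro y hy
    rw [hxy y hy, hx0]
  have hf0 : ∀ x ∉ tsupport f, f x = 0 := fun x hx => image_eq_zero_of_notMem_tsupport hx
  have hev : ∀ᶠ j in atTop, (φ j).rOut ≤ r := hφ.eventually (ge_mem_nhds hr)
  obtain ⟨B₀, hB₀⟩ := hf.continuous.bounded_above_of_compact_support hfc
  choose B hB using fun i => (hdc i).bounded_above_of_compact_support (hfc.fderiv_apply ℝ _)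
  obtain ⟨Γ, hΓ⟩ := hK.exists_bound_of_continuousOn (hγ.mono hrΩ)
  have hts : ∀ j, (φ j).rOut ≤ r → tsupport (F j) ⊆ K := fun j hj =>
    closure_minimal (fun x hx => by
      by_contra h
      exact hx (hzero hf0 j hj x h)) hK.isClosed
  have hnn : ∀ᶠ j in atTop, 0 ≤ ∫ x, (‖gradient (F j) x‖ ^ 2 - (γ x + c) * F j x ^ 2) *
      ‖ψ₀ x‖ ^ 2 := by
    filter_upwards [hev] with j hj
    exact integral_localized_nonneg_of_smooth hV hγ hA hψL2 hψ (hFs j)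
      (hK.of_isClosed_subset (isClosed_tsupport _) (hts j hj)) ((hts j hj).trans hrΩ)
  refine ge_of_tendsto ?_ hnn
  -- The weight `γ` is bounded only on `K`, but `F j` vanishes outside it. The absolute value of `Γ`
  -- covers an empty `K`, for which `Γ` may be negative.
  set D : ℝ := ∑ i, B i ^ 2 + (|Γ| + |c|) * B₀ ^ 2 with hD
  refine tendsto_integral_filter_of_dominated_convergence (fun x => D * ‖ψ₀ x‖ ^ 2) ?_ ?_ ?_ ?_
  · filter_upwards [hev] with j hj
    exact (continuous_localization_weight Ω.isOpen ((hFs j).of_le one_le_infty)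
      ((hts j hj).trans hrΩ) hγ c).aestronglyMeasurable.mul (hψ₀L.1.norm.pow 2)
  · filter_upwards [hev] with j hj
    refine Eventually.of_forall fun x => ?_
    rw [norm_mul, Real.norm_of_nonneg (sq_nonneg ‖ψ₀ x‖)]
    refine mul_le_mul_of_nonneg_right ?_ (sq_nonneg _)
    have hsum : ‖∑ i, partialDeriv i (F j) x ^ 2‖ ≤ ∑ i, B i ^ 2 := by
      refine norm_sum_le_of_le _ fun i _ => ?_
      rw [norm_pow, hFd]
      exact pow_le_pow_left₀ (norm_nonneg _) (hbound (hdc i) (hB i) j x) 2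
    have hsq : F j x ^ 2 ≤ B₀ ^ 2 := by
      rw [← sq_abs]
      exact pow_le_pow_left₀ (abs_nonneg _) (hbound hf.continuous hB₀ j x) 2
    rw [norm_gradient_sq_eq_sum]
    refine (norm_sub_le _ _).trans (add_le_add hsum ?_)
    rw [norm_mul, Real.norm_of_nonneg (sq_nonneg (F j x))]
    by_cases hx : x ∈ K
    · refine mul_le_mul ((norm_add_le _ _).trans (add_le_add ((hΓ x hx).trans (le_abs_self _)) le_rfl)) hsq
        (sq_nonneg _) (by positivity)
    · rw [show F j x = 0 from hzero hf0 j hj x hx]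
      simp only [ne_eq, OfNat.ofNat_ne_zero, not_false_eq_true, zero_pow, mul_zero]
      positivity
  · exact (hψ₀L.integrable_norm_pow (by norm_num)).const_mul D
  · refine Eventually.of_forall fun x => Tendsto.mul_const _ ?_
    simp_rw [norm_gradient_sq_eq_sum]
    refine Tendsto.sub (tendsto_finsetSum _ fun i _ => Tendsto.pow ?_ 2)
      (Tendsto.const_mul _ (Tendsto.pow ?_ 2))
    · simp_rw [hFd]
      exact ContDiffBump.convolution_tendsto_right_of_continuous hφ (hdc i) x
    · exact ContDiffBump.convolution_tendsto_right_of_continuous hφ hf.continuous x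

end Agmon

/-! ### Functions of the boundary distance and the cut-off weight -/

namespace Agmon

open scoped Topology
open Real (smoothTransition)

variable {n : ℕ}

theorem deriv_smoothTransition_of_nonpos {t : ℝ} (ht : t ≤ 0) : deriv smoothTransition t = 0 :=
  IsLocalMin.deriv_eq_zero (Eventually.of_forall fun s => by
    rw [smoothTransition.zero_of_nonpos ht]; exact smoothTransition.nonneg s)

theorem deriv_smoothTransition_of_one_le {t : ℝ} (ht : 1 ≤ t) : deriv smoothTransition t = 0 :=
  IsLocalMax.deriv_eq_zero (Eventually.of_forall fun s => by
    rw [smoothTransition.one_of_one_le ht]; exact smoothTransition.le_one s)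

theorem exists_abs_deriv_smoothTransition_le :
    ∃ C : ℝ, 0 < C ∧ ∀ t, |deriv smoothTransition t| ≤ C := by
  have hc : Continuous (deriv smoothTransition) :=
    (smoothTransition.contDiff (n := 1)).continuous_deriv (by norm_num)
  obtain ⟨C, hC⟩ := (isCompact_Icc (a := (0 : ℝ)) (b := 1)).exists_bound_of_continuousOn
    hc.continuousOn
  refine ⟨|C| + 1, by positivity, fun t => ?_⟩
  by_cases h0 : t ≤ 0
  · rw [deriv_smoothTransition_of_nonpos h0, abs_zero]; positivity
  by_cases h1 : 1 ≤ t
  · rw [deriv_smoothTransition_of_one_le h1, abs_zero]; positivity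
  have := hC t ⟨(not_le.1 h0).le, (not_le.1 h1).le⟩
  rw [Real.norm_eq_abs] at this
  linarith [le_abs_self C]

theorem norm_gradient_eq (f : EuclideanSpace ℝ (Fin n) → ℝ) (x : EuclideanSpace ℝ (Fin n)) :
    ‖gradient f x‖ = ‖fderiv ℝ f x‖ := by
  rw [gradient, LinearIsometryEquiv.norm_map]

section BoundaryDist

variable {Ω : Set (EuclideanSpace ℝ (Fin n))}

theorem abs_boundaryDist_sub_le (x y : EuclideanSpace ℝ (Fin n)) :
    |boundaryDist Ω x - boundaryDist Ω y| ≤ ‖x - y‖ := by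
  have := (Metric.lipschitz_infDist_pt (frontier Ω)).dist_le_mul x y
  rwa [NNReal.coe_one, one_mul, Real.dist_eq, dist_eq_norm] at this

theorem continuous_boundaryDist : Continuous (boundaryDist Ω) :=
  Metric.continuous_infDist_pt _

theorem norm_fderiv_boundaryDist_le (x : EuclideanSpace ℝ (Fin n)) :
    ‖fderiv ℝ (boundaryDist Ω) x‖ ≤ 1 :=
  (norm_fderiv_le_of_lipschitz ℝ (x₀ := x) (f := boundaryDist Ω)
    (Metric.lipschitz_infDist_pt (frontier Ω))).trans_eq NNReal.coe_one

/-- Without this, `Metric.infDist` would take its default value `0` and `boundaryDist` would carry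
no information. -/
theorem frontier_nonempty_of_isBounded (hn : 1 ≤ n) (hb : Bornology.IsBounded Ω)
    (hne : Ω.Nonempty) : (frontier Ω).Nonempty := by
  have : Nonempty (Fin n) := ⟨⟨0, hn⟩⟩
  rw [nonempty_iff_ne_empty, Ne, frontier_eq_empty_iff]
  rintro (h | h)
  · exact hne.ne_empty h
  · rw [h] at hb
    exact NormedSpace.unbounded_univ ℝ (EuclideanSpace ℝ (Fin n)) hb

theorem boundaryDist_pos (hn : 1 ≤ n) (hb : Bornology.IsBounded Ω) (ho : IsOpen Ω)
    {x : EuclideanSpace ℝ (Fin n)} (hx : x ∈ Ω) : 0 < boundaryDist Ω x := by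
  refine (isClosed_frontier.notMem_iff_infDist_pos
    (frontier_nonempty_of_isBounded hn hb ⟨x, hx⟩)).1 fun h => ?_
  rw [ho.frontier_eq] at h
  exact h.2 hx

/-- `Ω` may be replaced by its closure here, since the distance vanishes on the frontier; the set is
then closed and bounded. -/
theorem isCompact_le_boundaryDist (hb : Bornology.IsBounded Ω) (ho : IsOpen Ω) {ρ : ℝ}
    (hρ : 0 < ρ) : IsCompact {x | x ∈ Ω ∧ ρ ≤ boundaryDist Ω x} := by
  have : {x | x ∈ Ω ∧ ρ ≤ boundaryDist Ω x} = closure Ω ∩ {x | ρ ≤ boundaryDist Ω x} := by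
    ext x
    refine ⟨fun h => ⟨subset_closure h.1, h.2⟩, fun h => ⟨?_, h.2⟩⟩
    by_contra hx
    have hf : x ∈ frontier Ω := by rw [ho.frontier_eq]; exact ⟨h.1, hx⟩
    have h0 : boundaryDist Ω x = 0 := Metric.infDist_zero_of_mem hf
    have : ρ ≤ boundaryDist Ω x := h.2
    linarith
  rw [this]
  exact hb.isCompact_closure.inter_right (isClosed_le continuous_const continuous_boundaryDist)

theorem exists_isCollarWidth_of_lt {t : ℝ} (h0 : 0 < collarWidth Ω) (ht : t < collarWidth Ω) :
    ∃ δ, IsCollarWidth Ω δ ∧ t < δ := by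
  have hne : {δ | IsCollarWidth Ω δ}.Nonempty := by
    by_contra h
    rw [not_nonempty_iff_eq_empty] at h
    -- The supremum of the empty set is `0` by convention, so positivity of `collarWidth` forces a
    -- collar to exist.
    rw [collarWidth, h, Real.sSup_empty] at h0
    exact h0.false
  obtain ⟨δ, h1, h2⟩ := exists_lt_of_lt_csSup hne ht
  exact ⟨δ, h1, h2⟩

/-- Inside the collar this is the chain rule. Where `d ≥ d₀`, `d` need not be differentiable, but
`φ' = 0` there and `d` is Lipschitz, so the increment of the composite is `o(|y - x|)`. -/
theorem hasFDerivAt_comp_boundaryDist {d₀ : ℝ} (hd₀ : 0 < d₀) (hd : d₀ ≤ collarWidth Ω)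
    {φ : ℝ → ℝ} (hφ : ContDiffOn ℝ 1 φ (Ioi 0)) (hφ0 : ∀ t, d₀ ≤ t → deriv φ t = 0)
    {x : EuclideanSpace ℝ (Fin n)} (hx : x ∈ Ω) (hpos : 0 < boundaryDist Ω x) :
    HasFDerivAt (fun y => φ (boundaryDist Ω y))
      (deriv φ (boundaryDist Ω x) • fderiv ℝ (boundaryDist Ω) x) x := by
  have hφd : HasDerivAt φ (deriv φ (boundaryDist Ω x)) (boundaryDist Ω x) :=
    ((hφ.contDiffAt (Ioi_mem_nhds hpos)).differentiableAt (by norm_num)).hasDerivAt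
  rcases lt_or_ge (boundaryDist Ω x) d₀ with h | h
  · obtain ⟨δ, hδ, hlt⟩ := exists_isCollarWidth_of_lt (hd₀.trans_le hd) (h.trans_le hd)
    exact hφd.comp_hasFDerivAt x (hδ.2 x hx hlt).1.hasFDerivAt
  · rw [hφ0 _ h] at hφd ⊢
    rw [zero_smul]
    have h1 := hφd.isLittleO.comp_tendsto (continuous_boundaryDist (Ω := Ω)).continuousAt.tendsto
    have h2 : (fun y => boundaryDist Ω y - boundaryDist Ω x) =O[𝓝 x] fun y => y - x :=
      Asymptotics.isBigO_of_le _ fun y => abs_boundaryDist_sub_le y x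
    refine HasFDerivAt.of_isLittleO ?_
    simpa [Function.comp_def] using h1.trans_isBigO h2

/-- Inside the collar `∇d` is continuous, being differentiable. Where `d ≥ d₀`, `φ'(d)` tends to `0`
and `|∇d| ≤ 1`, so the gradient of the composite tends to `0`. -/
theorem contDiffOn_comp_boundaryDist (ho : IsOpen Ω) {d₀ : ℝ} (hd₀ : 0 < d₀)
    (hd : d₀ ≤ collarWidth Ω) (hpos : ∀ x ∈ Ω, 0 < boundaryDist Ω x)
    {φ : ℝ → ℝ} (hφ : ContDiffOn ℝ 1 φ (Ioi 0)) (hφ0 : ∀ t, d₀ ≤ t → deriv φ t = 0) :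
    ContDiffOn ℝ 1 (fun y => φ (boundaryDist Ω y)) Ω := by
  have hD := fun x hx => hasFDerivAt_comp_boundaryDist hd₀ hd hφ hφ0 (x := x) hx (hpos x hx)
  have hcφ : ∀ x ∈ Ω, ContinuousAt (fun y => deriv φ (boundaryDist Ω y)) x := fun x hx =>
    ContinuousAt.comp (g := deriv φ)
      ((hφ.continuousOn_deriv_of_isOpen isOpen_Ioi le_rfl).continuousAt (Ioi_mem_nhds (hpos x hx)))
      continuous_boundaryDist.continuousAt
  rw [show (1 : WithTop ℕ∞) = 0 + 1 by norm_num, contDiffOn_succ_iff_fderiv_of_isOpen ho]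
  refine ⟨fun x hx => (hD x hx).differentiableAt.differentiableWithinAt, by simp, ?_⟩
  rw [contDiffOn_zero]
  refine ContinuousOn.congr (f := fun x => deriv φ (boundaryDist Ω x) • fderiv ℝ (boundaryDist Ω) x)
    (fun x hx => ContinuousAt.continuousWithinAt ?_) fun x hx => (hD x hx).fderiv
  rcases lt_or_ge (boundaryDist Ω x) d₀ with h | h
  · obtain ⟨δ, hδ, hlt⟩ := exists_isCollarWidth_of_lt (hd₀.trans_le hd) (h.trans_le hd)
    exact (hcφ x hx).smul (hδ.2 x hx hlt).2.1.continuousAt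
  · have h0 := hcφ x hx
    rw [ContinuousAt, hφ0 _ h] at h0 ⊢
    rw [zero_smul]
    refine squeeze_zero_norm (fun y => ?_) (by simpa using h0.norm)
    rw [norm_smul]
    exact mul_le_of_le_one_right (norm_nonneg _) (norm_fderiv_boundaryDist_le y)

end BoundaryDist

/-- The cut-off Agmon weight `e^G`, vanishing on `(-∞, ρ]`. -/
def cutoffWeight (G : ℝ → ℝ) (ρ t : ℝ) : ℝ := Real.exp (G t) * smoothTransition (t / ρ - 1)

section CutoffWeight

variable {G : ℝ → ℝ} {ρ t : ℝ}

theorem contDiffOn_cutoffWeight (hG : ContDiffOn ℝ 1 G (Ioi 0)) (ρ : ℝ) :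
    ContDiffOn ℝ 1 (cutoffWeight G ρ) (Ioi 0) :=
  hG.exp.mul ((smoothTransition.contDiff.comp
    ((contDiff_id.div_const ρ).sub contDiff_const)).contDiffOn)

theorem deriv_cutoffWeight (hG : ContDiffOn ℝ 1 G (Ioi 0)) (ρ : ℝ) (ht : 0 < t) :
    deriv (cutoffWeight G ρ) t = Real.exp (G t) *
      (deriv G t * smoothTransition (t / ρ - 1) + deriv smoothTransition (t / ρ - 1) / ρ) := by
  have h1 : HasDerivAt G (deriv G t) t :=
    ((hG.contDiffAt (Ioi_mem_nhds ht)).differentiableAt (by norm_num)).hasDerivAt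
  have h2 : HasDerivAt smoothTransition (deriv smoothTransition (t / ρ - 1)) (t / ρ - 1) :=
    ((smoothTransition.contDiff (n := 1)).differentiable (by norm_num) _).hasDerivAt
  have h3 : HasDerivAt (fun s : ℝ => s / ρ - 1) (1 / ρ) t :=
    ((hasDerivAt_id t).div_const ρ).sub_const 1
  have h4 := h1.exp.mul (h2.comp t h3)
  refine (h4.deriv).trans ?_
  simp only [Function.comp_apply]
  ring

theorem cutoffWeight_of_le (hρ : 0 < ρ) (h : t ≤ ρ) : cutoffWeight G ρ t = 0 := by
  rw [cutoffWeight, smoothTransition.zero_of_nonpos, mul_zero]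
  have := (div_le_one hρ).2 h
  linarith

theorem deriv_cutoffWeight_of_two_mul_le (hG : ContDiffOn ℝ 1 G (Ioi 0)) (hρ : 0 < ρ)
    (h : 2 * ρ ≤ t) : deriv (cutoffWeight G ρ) t = deriv G t * Real.exp (G t) := by
  have h1 : 1 ≤ t / ρ - 1 := by
    have := (le_div_iff₀ hρ).2 h
    linarith
  rw [deriv_cutoffWeight hG ρ (by linarith), deriv_smoothTransition_of_one_le h1,
    smoothTransition.one_of_one_le h1]
  ring

theorem cutoffWeight_of_two_mul_le (hρ : 0 < ρ) (h : 2 * ρ ≤ t) :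
    cutoffWeight G ρ t = Real.exp (G t) := by
  have h1 : 1 ≤ t / ρ - 1 := by
    have := (le_div_iff₀ hρ).2 h
    linarith
  rw [cutoffWeight, smoothTransition.one_of_one_le h1, mul_one]

/-- With `χ` the cut-off factor, the squares of `G'` cancel and leave `e^{2G} (2 G' χ χ' + χ'²)`. As
`G' ≤ 1/t ≤ 1/ρ` and `|χ'| ≤ C/ρ`, both terms are of order `ρ⁻²`; monotonicity of `G` moves the
exponential to `2ρ`. -/
theorem deriv_cutoffWeight_sq_sub_le (hG : ContDiffOn ℝ 1 G (Ioi 0)) (hρ : 0 < ρ)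
    (hmono : MonotoneOn G (Ioi 0)) {C : ℝ} (hC : ∀ s, |deriv smoothTransition s| ≤ C)
    (ht1 : ρ ≤ t) (ht2 : t ≤ 2 * ρ) (hG0 : 0 ≤ deriv G t) (hG1 : deriv G t ≤ 1 / t) :
    deriv (cutoffWeight G ρ) t ^ 2 - deriv G t ^ 2 * cutoffWeight G ρ t ^ 2 ≤
      Real.exp (2 * G (2 * ρ)) * ((2 * C + C ^ 2) / ρ ^ 2) := by
  have ht : 0 < t := hρ.trans_le ht1
  rw [deriv_cutoffWeight hG ρ ht, cutoffWeight]
  set s := t / ρ - 1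
  set k := smoothTransition s
  set k' := deriv smoothTransition s
  set G' := deriv G t
  have hk0 : 0 ≤ k := smoothTransition.nonneg s
  have hk1 : k ≤ 1 := smoothTransition.le_one s
  have hC0 : 0 ≤ C := (abs_nonneg _).trans (hC s)
  have hk' : k' ≤ C := (le_abs_self _).trans (hC s)
  have hk'2 : k' ^ 2 ≤ C ^ 2 := by
    rw [← sq_abs]; exact pow_le_pow_left₀ (abs_nonneg _) (hC s) 2
  have hGρ : G' ≤ 1 / ρ := hG1.trans (one_div_le_one_div_of_le hρ ht1)
  have hexp : Real.exp (G t) ^ 2 ≤ Real.exp (2 * G (2 * ρ)) := by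
    rw [← Real.exp_nat_mul]
    refine Real.exp_le_exp.2 ?_
    push_cast
    have := hmono (mem_Ioi.2 ht) (mem_Ioi.2 (by linarith)) ht2
    linarith
  have hb : 2 * (G' * k) * (k' / ρ) + (k' / ρ) ^ 2 ≤ (2 * C + C ^ 2) / ρ ^ 2 := by
    have h1 : G' * k ≤ 1 / ρ := (mul_le_of_le_one_right hG0 hk1).trans hGρ
    have h2 : G' * k * (k' / ρ) ≤ 1 / ρ * (C / ρ) := by
      have h3 : G' * k * (k' / ρ) ≤ G' * k * (C / ρ) :=
        mul_le_mul_of_nonneg_left (by gcongr) (mul_nonneg hG0 hk0)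
      exact h3.trans (mul_le_mul_of_nonneg_right h1 (by positivity))
    have h4 : (k' / ρ) ^ 2 ≤ C ^ 2 / ρ ^ 2 := by rw [div_pow]; gcongr
    have h5 : (2 * C + C ^ 2) / ρ ^ 2 = 2 * (1 / ρ * (C / ρ)) + C ^ 2 / ρ ^ 2 := by
      field_simp
    rw [h5]; linarith
  calc (Real.exp (G t) * (G' * k + k' / ρ)) ^ 2 - G' ^ 2 * (Real.exp (G t) * k) ^ 2
      = Real.exp (G t) ^ 2 * (2 * (G' * k) * (k' / ρ) + (k' / ρ) ^ 2) := by ring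
    _ ≤ Real.exp (G t) ^ 2 * ((2 * C + C ^ 2) / ρ ^ 2) :=
        mul_le_mul_of_nonneg_left hb (sq_nonneg _)
    _ ≤ _ := mul_le_mul_of_nonneg_right hexp (by positivity)

end CutoffWeight

/-! ### The Agmon estimate -/

theorem monotoneOn_of_conditionSigma {G : ℝ → ℝ} (hG : ContDiffOn ℝ 1 G (Ioi 0)) {d₀ : ℝ}
    (h1 : ∀ t ∈ Ioo 0 d₀, 0 ≤ deriv G t ∧ deriv G t ≤ 1 / t) (h2 : ∀ t, d₀ ≤ t → deriv G t = 0) :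
    MonotoneOn G (Ioi 0) := by
  refine monotoneOn_of_deriv_nonneg (convex_Ioi 0) hG.continuousOn ?_ fun t ht => ?_
  · rw [interior_Ioi]; exact hG.differentiableOn (by norm_num)
  · rw [interior_Ioi] at ht
    rcases lt_or_ge t d₀ with h | h
    · exact (h1 t ⟨ht, h⟩).1
    · exact (h2 t h).ge

/-- The Agmon estimate: the mass of a weak solution away from the boundary is controlled by its mass
in a thin shell. -/
theorem integral_le_integral_shell (hn : 1 ≤ n) {Ω : Opens (EuclideanSpace ℝ (Fin n))}
    (hbdd : Bornology.IsBounded (Ω : Set (EuclideanSpace ℝ (Fin n))))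
    {V : EuclideanSpace ℝ (Fin n) → ℝ} (hV : MemLinftyLoc Ω V) {G : ℝ → ℝ}
    (hG : ContDiffOn ℝ 1 G (Ioi 0)) {d₀ : ℝ} (hd₀ : 0 < d₀)
    (hd : d₀ ≤ collarWidth (Ω : Set (EuclideanSpace ℝ (Fin n))))
    (hG1 : ∀ t ∈ Ioo 0 d₀, 0 ≤ deriv G t ∧ deriv G t ≤ 1 / t)
    (hG2 : ∀ t, d₀ ≤ t → deriv G t = 0) {g : EuclideanSpace ℝ (Fin n) → ℝ}
    (hg : ∀ x ∈ Ω, g x = G (boundaryDist (Ω : Set (EuclideanSpace ℝ (Fin n))) x))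
    {E c : ℝ} (hc : 0 < c)
    (hA : ∀ φ : 𝓓(Ω, ℂ), c * ∫ x in Ω, ‖φ x‖ ^ 2 ≤
      (pairing Ω φ (fun x => schrodinger Ω V φ x - (E : ℂ) * φ x)).re
        - ∫ x in Ω, ‖gradient g x‖ ^ 2 * ‖φ x‖ ^ 2)
    {ψ : EuclideanSpace ℝ (Fin n) → ℂ} (hψL2 : MemLp ψ 2 (volume.restrict Ω))
    (hψ : ∀ φ : 𝓓(Ω, ℂ), pairing Ω ψ (fun x => schrodinger Ω V φ x - (E : ℂ) * φ x) = 0)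
    {C : ℝ} (hC : ∀ s, |deriv smoothTransition s| ≤ C) {r ρ : ℝ} (hρ : 0 < ρ) (hρr : 2 * ρ ≤ r)
    (hρd : 2 * ρ ≤ d₀) :
    c * Real.exp (2 * G r) * ∫ x in {x | x ∈ Ω ∧ r ≤ boundaryDist (Ω : Set _) x}, ‖ψ x‖ ^ 2 ≤
      Real.exp (2 * G (2 * ρ)) * ((2 * C + C ^ 2) / ρ ^ 2) *
        ∫ x in {x | x ∈ Ω ∧ boundaryDist (Ω : Set _) x ∈ Ico ρ (2 * ρ)}, ‖ψ x‖ ^ 2 := by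
  set d := boundaryDist (Ω : Set (EuclideanSpace ℝ (Fin n))) with hddef
  have hdc : Continuous d := continuous_boundaryDist
  have hmono := monotoneOn_of_conditionSigma hG hG1 hG2
  have hpos : ∀ x ∈ (Ω : Set (EuclideanSpace ℝ (Fin n))), 0 < d x := fun x hx =>
    boundaryDist_pos hn hbdd Ω.isOpen hx
  have hΩm : MeasurableSet (Ω : Set (EuclideanSpace ℝ (Fin n))) := Ω.isOpen.measurableSet
  set F := cutoffWeight G ρ with hF
  have hFs : ContDiffOn ℝ 1 F (Ioi 0) := contDiffOn_cutoffWeight hG ρ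
  -- Because `2ρ ≤ d₀`, the cut-off is already `1` where `G` stops varying, so `F` composes with `d`
  -- as regularly as `G` does.
  have hF0 : ∀ t, d₀ ≤ t → deriv F t = 0 := fun t ht => by
    rw [hF, deriv_cutoffWeight_of_two_mul_le hG hρ (hρd.trans ht), hG2 t ht, zero_mul]
  have hgrad : ∀ {u : EuclideanSpace ℝ (Fin n) → ℝ} {φ : ℝ → ℝ}, (∀ x ∈ Ω, u x = φ (d x)) →
      ContDiffOn ℝ 1 φ (Ioi 0) → (∀ t, d₀ ≤ t → deriv φ t = 0) → ∀ x ∈ Ω,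
      ‖gradient u x‖ ^ 2 = deriv φ (d x) ^ 2 * ‖fderiv ℝ d x‖ ^ 2 := by
    intro u φ hu hφ hφ0 x hx
    have he : u =ᶠ[𝓝 x] fun y => φ (d y) := by
      filter_upwards [Ω.isOpen.mem_nhds hx] with y hy using hu y hy
    rw [norm_gradient_eq, he.fderiv_eq,
      (hasFDerivAt_comp_boundaryDist hd₀ hd hφ hφ0 hx (hpos x hx)).fderiv, norm_smul, mul_pow,
      Real.norm_eq_abs, sq_abs]
  have hγ : ContinuousOn (fun x => ‖gradient g x‖ ^ 2) (Ω : Set (EuclideanSpace ℝ (Fin n))) := by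
    have hgs : ContDiffOn ℝ 1 g Ω :=
      (contDiffOn_comp_boundaryDist Ω.isOpen hd₀ hd hpos hG hG2).congr hg
    simp_rw [norm_gradient_eq]
    exact ((hgs.continuousOn_fderiv_of_isOpen Ω.isOpen le_rfl).norm).pow 2
  -- The distance to the frontier is also positive in the exterior of `Ω`, so the weight must be cut
  -- to `Ω`. No smoothness is lost, because the support lies in the compact `S ⊆ Ω`.
  set f : EuclideanSpace ℝ (Fin n) → ℝ :=
    (Ω : Set (EuclideanSpace ℝ (Fin n))).indicator fun x => F (d x) with hf
  have hfeq : ∀ x ∈ Ω, f x = F (d x) := fun x hx => indicator_of_mem hx _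
  set S := {x | x ∈ (Ω : Set (EuclideanSpace ℝ (Fin n))) ∧ ρ ≤ d x} with hS
  have hSc : IsCompact S := isCompact_le_boundaryDist hbdd Ω.isOpen hρ
  have hfS : ∀ x ∉ S, f x = 0 := by
    intro x hx
    by_cases hxΩ : x ∈ Ω
    · rw [hfeq x hxΩ]
      exact cutoffWeight_of_le hρ (not_le.1 fun h => hx ⟨hxΩ, h⟩).le
    · exact indicator_of_notMem hxΩ _
  have hts : tsupport f ⊆ S :=
    closure_minimal (fun x hx => by
      by_contra h
      exact hx (hfS x h)) hSc.isClosed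
  have hfs : ContDiff ℝ 1 f := by
    refine contDiff_iff_contDiffAt.2 fun x => ?_
    by_cases hx : x ∈ tsupport f
    swap
    · exact contDiffAt_const.congr_of_eventuallyEq (notMem_tsupport_iff_eventuallyEq.1 hx)
    have hxΩ : x ∈ (Ω : Set (EuclideanSpace ℝ (Fin n))) := (hts hx).1
    exact ((contDiffOn_comp_boundaryDist Ω.isOpen hd₀ hd hpos hFs hF0).congr hfeq).contDiffAt
      (Ω.isOpen.mem_nhds hxΩ)
  have hfc : HasCompactSupport f := HasCompactSupport.intro hSc hfS
  have hfΩ : tsupport f ⊆ Ω := hts.trans fun x hx => hx.1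
  have key := integral_localized_nonneg hV hγ hA hψL2 hψ hfs hfc hfΩ
  set ψ₀ := (Ω : Set (EuclideanSpace ℝ (Fin n))).indicator ψ with hψ₀
  have hψ₀L : MemLp ψ₀ 2 := (memLp_indicator_iff_restrict hΩm).2 hψL2
  have hN : Integrable fun x => ‖ψ₀ x‖ ^ 2 := hψ₀L.integrable_norm_pow (by norm_num)
  set S₁ := {x | x ∈ Ω ∧ d x ∈ Ico ρ (2 * ρ)} with hS₁
  set S₂ := {x | x ∈ Ω ∧ r ≤ d x} with hS₂
  have hm₁ : MeasurableSet S₁ := hΩm.inter (hdc.measurable measurableSet_Ico)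
  have hm₂ : MeasurableSet S₂ := hΩm.inter (hdc.measurable measurableSet_Ici)
  set D := Real.exp (2 * G (2 * ρ)) * ((2 * C + C ^ 2) / ρ ^ 2) with hD
  have hC0 : 0 ≤ C := (abs_nonneg _).trans (hC 0)
  have hD0 : 0 ≤ D := by positivity
  -- Three regions: for `d < ρ` everything vanishes, in the shell the remainder is at most `D`, and
  -- for `d ≥ 2ρ` only `-c e^{2G}` survives, where monotonicity of `G` gives `e^{2G} ≥ e^{2G(r)}`
  -- once `d ≥ r`.
  have hpt : ∀ x, (‖gradient f x‖ ^ 2 - (‖gradient g x‖ ^ 2 + c) * f x ^ 2) * ‖ψ₀ x‖ ^ 2 ≤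
      D * S₁.indicator (fun x => ‖ψ₀ x‖ ^ 2) x -
        c * Real.exp (2 * G r) * S₂.indicator (fun x => ‖ψ₀ x‖ ^ 2) x := by
    intro x
    by_cases hx : x ∈ Ω
    swap
    · rw [hψ₀, indicator_of_notMem hx, indicator_of_notMem (fun h => hx h.1),
        indicator_of_notMem (fun h => hx h.1)]
      simp
    have hdx := hpos x hx
    rw [hgrad hfeq hFs hF0 x hx, hgrad hg hG hG2 x hx, hfeq x hx]
    have hgd : ‖fderiv ℝ d x‖ ^ 2 ≤ 1 :=
      pow_le_one₀ (norm_nonneg _) (norm_fderiv_boundaryDist_le x)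
    have hrw : deriv F (d x) ^ 2 * ‖fderiv ℝ d x‖ ^ 2 -
        (deriv G (d x) ^ 2 * ‖fderiv ℝ d x‖ ^ 2 + c) * F (d x) ^ 2 =
        (deriv F (d x) ^ 2 - deriv G (d x) ^ 2 * F (d x) ^ 2) * ‖fderiv ℝ d x‖ ^ 2 -
          c * F (d x) ^ 2 := by ring
    rw [hrw]
    have hNx : 0 ≤ ‖ψ₀ x‖ ^ 2 := sq_nonneg _
    rcases lt_or_ge (d x) ρ with h1 | h1
    · have hF' : deriv F (d x) = 0 := by
        have he : F =ᶠ[𝓝 (d x)] fun _ => 0 := by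
          filter_upwards [Iio_mem_nhds h1] with s hs using cutoffWeight_of_le hρ (le_of_lt hs)
        rw [he.deriv_eq, deriv_const]
      rw [show F (d x) = 0 from cutoffWeight_of_le hρ h1.le, hF',
        indicator_of_notMem (fun h => h1.not_ge h.2.1),
        indicator_of_notMem (fun h => by have := h.2; linarith)]
      simp
    rcases lt_or_ge (d x) (2 * ρ) with h2 | h2
    · rw [indicator_of_mem (show x ∈ S₁ from ⟨hx, h1, h2⟩),
        indicator_of_notMem (fun h => by have := h.2; linarith), mul_zero, sub_zero]
      refine mul_le_mul_of_nonneg_right ?_ hNx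
      have hb := hG1 (d x) ⟨hdx, h2.trans_le hρd⟩
      have hle := deriv_cutoffWeight_sq_sub_le hG hρ hmono hC h1 h2.le hb.1 hb.2
      have hle2 : (deriv F (d x) ^ 2 - deriv G (d x) ^ 2 * F (d x) ^ 2) * ‖fderiv ℝ d x‖ ^ 2 ≤ D :=
        (mul_le_mul_of_nonneg_right hle (sq_nonneg _)).trans (mul_le_of_le_one_right hD0 hgd)
      have : 0 ≤ c * F (d x) ^ 2 := by positivity
      linarith
    · have hF1 : F (d x) = Real.exp (G (d x)) := cutoffWeight_of_two_mul_le hρ h2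
      have hF2 : deriv F (d x) = deriv G (d x) * Real.exp (G (d x)) :=
        deriv_cutoffWeight_of_two_mul_le hG hρ h2
      rw [hF2, hF1, indicator_of_notMem (fun h => h2.not_gt h.2.2), mul_pow, sub_self, zero_mul,
        zero_sub, mul_zero, zero_sub, neg_mul, neg_le_neg_iff]
      by_cases h3 : r ≤ d x
      · rw [indicator_of_mem (show x ∈ S₂ from ⟨hx, h3⟩)]
        refine mul_le_mul_of_nonneg_right (mul_le_mul_of_nonneg_left ?_ hc.le) hNx
        rw [← Real.exp_nat_mul]
        refine Real.exp_le_exp.2 ?_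
        push_cast
        have := hmono (mem_Ioi.2 (by linarith)) (mem_Ioi.2 hdx) h3
        linarith
      · rw [indicator_of_notMem (fun h => h3 h.2), mul_zero]
        positivity
  have hI1 : Integrable fun x => (‖gradient f x‖ ^ 2 - (‖gradient g x‖ ^ 2 + c) * f x ^ 2) *
      ‖ψ₀ x‖ ^ 2 := by
    have hcw := continuous_localization_weight Ω.isOpen hfs hfΩ hγ c
    obtain ⟨B, hB⟩ := hcw.bounded_above_of_compact_support
      (HasCompactSupport.intro hfc fun x hx => by
        rw [norm_gradient_sq_eq_sum, image_eq_zero_of_notMem_tsupport hx]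
        simp [partialDeriv_eq_zero_of_notMem_tsupport _ hx])
    exact hN.bdd_mul (c := B) hcw.aestronglyMeasurable (Eventually.of_forall hB)
  have hI2 := (hN.indicator hm₁).const_mul D
  have hI3 := (hN.indicator hm₂).const_mul (c * Real.exp (2 * G r))
  have hle := key.trans (integral_mono hI1 (hI2.sub hI3) hpt)
  rw [integral_sub' hI2 hI3, integral_const_mul, integral_const_mul, integral_indicator hm₁,
    integral_indicator hm₂] at hle
  have hψS : ∀ T : Set (EuclideanSpace ℝ (Fin n)), MeasurableSet T → (∀ x ∈ T, x ∈ Ω) →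
      ∫ x in T, ‖ψ₀ x‖ ^ 2 = ∫ x in T, ‖ψ x‖ ^ 2 := fun T hT hTΩ =>
    setIntegral_congr_fun hT fun x hx => by
      simp only [hψ₀]
      rw [indicator_of_mem (show x ∈ (Ω : Set _) from hTΩ x hx)]
  rw [hψS S₁ hm₁ fun x hx => hx.1, hψS S₂ hm₂ fun x hx => hx.1] at hle
  linarith

/-! ### Summation over dyadic shells -/

theorem ae_eq_zero_of_isWeakSolution (n : ℕ) (hn : 1 ≤ n)
    (Ω : TopologicalSpace.Opens (EuclideanSpace ℝ (Fin n)))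
    (hbdd : Bornology.IsBounded (Ω : Set (EuclideanSpace ℝ (Fin n))))
    (V : EuclideanSpace ℝ (Fin n) → ℝ) (hV : MemLinftyLoc Ω V)
    (G : ℝ → ℝ)
    (hG : ConditionSigma (collarWidth (Ω : Set (EuclideanSpace ℝ (Fin n)))) G)
    (g : EuclideanSpace ℝ (Fin n) → ℝ)
    (hg : ∀ x ∈ Ω, g x = G (boundaryDist (Ω : Set (EuclideanSpace ℝ (Fin n))) x))
    (E c : ℝ) (hc : 0 < c)
    (hAgmon : ∀ φ : 𝓓(Ω, ℂ),
      c * ∫ x in Ω, ‖φ x‖ ^ 2 ≤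
        (pairing Ω φ (fun x => schrodinger Ω V φ x - (E : ℂ) * φ x)).re
          - ∫ x in Ω, ‖gradient g x‖ ^ 2 * ‖φ x‖ ^ 2)
    (ψ : EuclideanSpace ℝ (Fin n) → ℂ) (hψL2 : MemLp ψ 2 (volume.restrict Ω))
    (hψ : IsWeakSolution Ω V E ψ) :
    ψ =ᵐ[volume.restrict Ω] 0 := by
  obtain ⟨d₀, hd₀, hd, hG1, hG2, hsum⟩ := hG.exists_d₀
  obtain ⟨C, hCpos, hC⟩ := exists_abs_deriv_smoothTransition_le
  set d := boundaryDist (Ω : Set (EuclideanSpace ℝ (Fin n))) with hddef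
  have hdc : Continuous d := continuous_boundaryDist
  have hΩm : MeasurableSet (Ω : Set (EuclideanSpace ℝ (Fin n))) := Ω.isOpen.measurableSet
  have hN : IntegrableOn (fun x => ‖ψ x‖ ^ 2) Ω := hψL2.integrable_norm_pow (by norm_num)
  have hzero : ∀ r : ℝ, 0 < r → ∫ x in {x | x ∈ Ω ∧ r ≤ d x}, ‖ψ x‖ ^ 2 = 0 := by
    intro r hr
    set I := ∫ x in {x | x ∈ Ω ∧ r ≤ d x}, ‖ψ x‖ ^ 2 with hI
    have hI0 : 0 ≤ I := integral_nonneg fun x => sq_nonneg _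
    by_contra hne
    have hIpos : 0 < I := lt_of_le_of_ne hI0 (Ne.symm hne)
    -- The bound by `r` puts every shell below level `r`; the bound by `d₀ / 2` is the range allowed
    -- in (Σ).
    set ρ₀ := min r (d₀ / 2) with hρ₀
    have hρ₀pos : 0 < ρ₀ := lt_min hr (by positivity)
    -- The extra factor `1/2` makes the outer radius `2 * ρ k` the point `2⁻ᵏ ρ₀` at which (Σ)
    -- evaluates `G`.
    set ρ : ℕ → ℝ := fun k => (2 : ℝ)⁻¹ ^ k * ρ₀ / 2 with hρ
    have hρpos : ∀ k, 0 < ρ k := fun k => by positivity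
    have h2ρ : ∀ k, 2 * ρ k = (2 : ℝ)⁻¹ ^ k * ρ₀ := fun k => by rw [hρ]; ring
    have h2ρle : ∀ k, 2 * ρ k ≤ ρ₀ := fun k => by
      rw [h2ρ]
      exact mul_le_of_le_one_left hρ₀pos.le (pow_le_one₀ (by norm_num) (by norm_num))
    set T : ℕ → Set (EuclideanSpace ℝ (Fin n)) := fun k => {x | x ∈ Ω ∧ d x ∈ Ico (ρ k) (2 * ρ k)}
      with hT
    have hTm : ∀ k, MeasurableSet (T k) := fun k => hΩm.inter (hdc.measurable measurableSet_Ico)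
    have hTlt : ∀ j k, j < k → Disjoint (T j) (T k) := by
      intro j k hjk
      rw [Set.disjoint_left]
      rintro x ⟨-, h1, -⟩ ⟨-, -, h2⟩
      have h3 : (2 : ℝ)⁻¹ ^ k ≤ (2 : ℝ)⁻¹ ^ (j + 1) :=
        pow_le_pow_of_le_one (by norm_num) (by norm_num) hjk
      have h4 : 2 * ρ k ≤ ρ j := by
        rw [h2ρ]
        refine (mul_le_mul_of_nonneg_right h3 hρ₀pos.le).trans (le_of_eq ?_)
        rw [hρ, pow_succ]
        ring
      exact (h2.trans_le h4).not_ge h1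
    -- Here `1 / ρ k ^ 2 = 4 * 4 ^ k / ρ₀ ^ 2`; the factor `4 ^ k` is absorbed by the weight `4⁻ᵏ`
    -- of (Σ), so `D` does not depend on `k`.
    set D := (2 * C + C ^ 2) * 4 / ρ₀ ^ 2 with hD
    have hD0 : 0 < D := by positivity
    set m := c * Real.exp (2 * G r) * I with hm
    have hmpos : 0 < m := by positivity
    have hterm : ∀ k, (4 : ℝ)⁻¹ ^ k * Real.exp (-2 * G ((2 : ℝ)⁻¹ ^ k * ρ₀)) * m ≤
        D * ∫ x in T k, ‖ψ x‖ ^ 2 := by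
      intro k
      have h := integral_le_integral_shell hn hbdd hV hG.contDiffOn hd₀ hd hG1 hG2 hg hc hAgmon
        hψL2 hψ.2 hC (hρpos k) ((h2ρle k).trans (min_le_left _ _))
        ((h2ρle k).trans ((min_le_right _ _).trans (by linarith)))
      rw [h2ρ k] at h
      have h' := mul_le_mul_of_nonneg_left h
        (show 0 ≤ (4 : ℝ)⁻¹ ^ k * Real.exp (-2 * G ((2 : ℝ)⁻¹ ^ k * ρ₀)) by positivity)
      refine h'.trans (le_of_eq ?_)
      have he : Real.exp (-2 * G ((2 : ℝ)⁻¹ ^ k * ρ₀)) * Real.exp (2 * G ((2 : ℝ)⁻¹ ^ k * ρ₀)) =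
          1 := by rw [← Real.exp_add]; simp
      have h4 : (4 : ℝ)⁻¹ ^ k = ((2 : ℝ)⁻¹ ^ k) ^ 2 := by
        rw [← pow_mul, mul_comm, pow_mul]; norm_num
      have hcoef : (4 : ℝ)⁻¹ ^ k * ((2 * C + C ^ 2) / ρ k ^ 2) = D := by
        rw [h4, hρ, hD]
        field_simp
        norm_num
      have hTk : T k = {x | x ∈ Ω ∧ d x ∈ Ico (ρ k) ((2 : ℝ)⁻¹ ^ k * ρ₀)} := by rw [← h2ρ k]
      rw [← hddef, ← hTk]
      calc _ = ((4 : ℝ)⁻¹ ^ k * ((2 * C + C ^ 2) / ρ k ^ 2)) *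
            (Real.exp (-2 * G ((2 : ℝ)⁻¹ ^ k * ρ₀)) * Real.exp (2 * G ((2 : ℝ)⁻¹ ^ k * ρ₀))) *
            ∫ x in T k, ‖ψ x‖ ^ 2 := by ring
        _ = _ := by rw [he, hcoef, mul_one]
    have hbound : ∀ N : ℕ, (∑ k ∈ Finset.Icc 1 N,
        (4 : ℝ)⁻¹ ^ k * Real.exp (-2 * G ((2 : ℝ)⁻¹ ^ k * ρ₀))) * m ≤
        D * ∫ x in Ω, ‖ψ x‖ ^ 2 := by
      intro N
      rw [Finset.sum_mul]
      refine (Finset.sum_le_sum fun k _ => hterm k).trans ?_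
      rw [← Finset.mul_sum]
      refine mul_le_mul_of_nonneg_left ?_ hD0.le
      rw [← integral_biUnion_finset _ (fun k _ => hTm k)
        (fun j _ k _ hjk => by
          rcases lt_or_gt_of_ne hjk with h | h
          · exact hTlt j k h
          · exact (hTlt k j h).symm)
        (fun k _ => hN.mono_set fun x hx => hx.1)]
      exact setIntegral_mono_set hN (Eventually.of_forall fun x => sq_nonneg _)
        (LE.le.eventuallyLE (iUnion₂_subset fun k _ x hx => hx.1))
    -- If the mass beyond `r` were positive, the divergent sum would exceed the bound given by the
    -- total mass.
    have htop := (hsum ρ₀ hρ₀pos (min_le_right _ _)).atTop_mul_const hmpos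
    obtain ⟨N, hN'⟩ := (htop.eventually (eventually_gt_atTop (D * ∫ x in Ω, ‖ψ x‖ ^ 2))).exists
    exact (hbound N).not_gt hN'
  have hunion : (Ω : Set (EuclideanSpace ℝ (Fin n))) =
      ⋃ k : ℕ, {x | x ∈ Ω ∧ 1 / ((k : ℝ) + 1) ≤ d x} := by
    ext x
    simp only [mem_iUnion]
    refine ⟨fun hx => ?_, fun ⟨k, hk⟩ => hk.1⟩
    obtain ⟨k, hk⟩ := exists_nat_one_div_lt (boundaryDist_pos hn hbdd Ω.isOpen hx)
    exact ⟨k, hx, hk.le⟩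
  rw [hunion, EventuallyEq, ae_restrict_iUnion_iff]
  intro k
  have h := (integral_eq_zero_iff_of_nonneg (fun x => sq_nonneg ‖ψ x‖)
    (hN.mono_set fun x hx => hx.1)).1 (hzero (1 / ((k : ℝ) + 1)) (by positivity))
  filter_upwards [h] with x hx
  simpa using hx

end Agmon

end

theorem theorem2 (n : ℕ) (hn : 1 ≤ n)
    (Ω : TopologicalSpace.Opens (EuclideanSpace ℝ (Fin n)))
    (hbdd : Bornology.IsBounded (Ω : Set (EuclideanSpace ℝ (Fin n))))
    (hC2 : Agmon.HasC2Boundary (Ω : Set (EuclideanSpace ℝ (Fin n))))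
    (V : EuclideanSpace ℝ (Fin n) → ℝ) (hV : Agmon.MemLinftyLoc Ω V)
    (G : ℝ → ℝ)
    (hG : Agmon.ConditionSigma (Agmon.collarWidth (Ω : Set (EuclideanSpace ℝ (Fin n)))) G)
    (g : EuclideanSpace ℝ (Fin n) → ℝ)
    (hg : ∀ x ∈ Ω, g x = G (Agmon.boundaryDist (Ω : Set (EuclideanSpace ℝ (Fin n))) x))
    (E c : ℝ) (hc : 0 < c)
    (hAgmon : ∀ φ : 𝓓(Ω, ℂ),
      c * ∫ x in Ω, ‖φ x‖ ^ 2 ≤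
        (Agmon.pairing Ω φ (fun x => Agmon.schrodinger Ω V φ x - (E : ℂ) * φ x)).re
          - ∫ x in Ω, ‖gradient g x‖ ^ 2 * ‖φ x‖ ^ 2)
    (ψ : EuclideanSpace ℝ (Fin n) → ℂ) (hψL2 : MemLp ψ 2 (volume.restrict Ω))
    (hψ : Agmon.IsWeakSolution Ω V E ψ) :
    ψ =ᵐ[volume.restrict Ω] 0 :=
  Agmon.ae_eq_zero_of_isWeakSolution n hn Ω hbdd V hV G hG g hg E c hc hAgmon ψ hψL2 hψ
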